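/- Let $n\ge 2$ and let $\mathbb{H}^n$ be hyperbolic space of curvature $-1$, with distance $d$. On $\mathbb{H}^n\times\mathbb{R}$ consider the Lorentzian metric $g_{\mathbb{H}^n}-dt^2$. For a $C^2$ function $u$ on an open set $U\subset\mathbb{H}^n$, the graph $\Gamma_u=\{(p,u(p))\}$ over $U$ is called a space-like translator if its induced metric is positive definite and its mean curvature vector (the trace of the second fundamental form) satisfies $\mathbf{H}=\partial_t^{\perp}$, where $\perp$ denotes the orthogonal projection to the normal bundle of the graph. Let $c\in\mathbb{H}^n$ and $r>0$; let $B(c,r)$ be the open geodesic ball, $\bar B(c,r)$ the closed one, and $\Omega=B(c,r)\setminus\{c\}$. Let $u:\bar B(c,r)\to\mathbb{R}$ be continuous on $\bar B(c,r)\setminus\{c\}$ and of class $C^2$ on $\Omega$, such that the graph of $u$ over $\Omega$ is a space-like translator (nothing is assumed about $u$ at $c$) and $u$ is constant on $\partial B(c,r)$. Let $\Gamma_u$ be the graph of $u$ over $\bar B(c,r)$. Then: 1. $\Gamma_u$ is rotationally invariant: it is invariant under $\sigma\times\mathrm{id}$ for every isometry $\sigma$ of $\mathbb{H}^n$ with $\sigma(c)=c$.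 2. If in addition $u\in C^2(B(c,r))$, then $\Gamma_u$ is a compact piece of the bowl with axis $\{c\}\times\mathbb{R}$. That is, $\Gamma_u$ is compact, and there is $f:[0,\infty)\to\mathbb{R}$ with $$\Gamma_u=\{(p,f(d(p,c))) : p\in\mathbb{H}^n\}\cap\big(\bar B(c,r)\times\mathbb{R}\big),$$ where $f$ is a primitive of a continuous function $w:[0,\infty)\to(-1,1)$ with $w(0)=0$ and $$w'(s)=\big(1-w(s)^2\big)\big(1-(n-1)\coth(s)\,w(s)\big)\qquad (s>0).$$ (The bowl is, by definition, the graph of $p\mapsto f(d(p,c))$ over all of $\mathbb{H}^n$ for such an $f$.) -/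

import Mathlib

namespace HESU

/-! ### The hyperboloid model of hyperbolic space -/

/-- The Lorentz form `x₁y₁ + … + xₙyₙ - xₙ₊₁yₙ₊₁` on `ℝⁿ⁺¹`. -/
def lorentz {n : ℕ} (x y : Fin (n + 1) → ℝ) : ℝ :=
  (∑ i : Fin n, x i.castSucc * y i.castSucc) - x (Fin.last n) * y (Fin.last n)

/-- Hyperbolic space `ℍⁿ`: the upper sheet of the hyperboloid `⟨p, p⟩ = -1`,
with the subspace topology. -/
abbrev Hyp (n : ℕ) : Type :=
  {p : Fin (n + 1) → ℝ // lorentz p p = -1 ∧ 0 < p (Fin.last n)}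

/-- The Riemannian distance of `ℍⁿ`: `cosh d(p, q) = -⟨p, q⟩`. -/
noncomputable def hdist {n : ℕ} (p q : Hyp n) : ℝ :=
  Real.arcosh (-lorentz p.1 q.1)

/-- Open geodesic ball `B(c, r)`. -/
def ball {n : ℕ} (c : Hyp n) (r : ℝ) : Set (Hyp n) := {p | hdist p c < r}

/-- Closed geodesic ball. -/
def closedBall {n : ℕ} (c : Hyp n) (r : ℝ) : Set (Hyp n) := {p | hdist p c ≤ r}

/-- Geodesic sphere, the boundary of `B(c, r)`. -/
def sphere {n : ℕ} (c : Hyp n) (r : ℝ) : Set (Hyp n) := {p | hdist p c = r}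

/-- Punctured geodesic ball `B*(c, r)`. -/
def puncturedBall {n : ℕ} (c : Hyp n) (r : ℝ) : Set (Hyp n) := ball c r \ {c}

/-- The point `(x, √(1 + |x|²))`, as a vector. -/
noncomputable def chartVec {n : ℕ} (x : Fin n → ℝ) : Fin (n + 1) → ℝ :=
  Fin.snoc (α := fun _ => ℝ) x (Real.sqrt (1 + ∑ i, x i ^ 2))

theorem chartVec_mem {n : ℕ} (x : Fin n → ℝ) :
    lorentz (chartVec x) (chartVec x) = -1 ∧ 0 < chartVec x (Fin.last n) := by
  have h : 0 < 1 + ∑ i, x i ^ 2 :=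
    add_pos_of_pos_of_nonneg one_pos (Finset.sum_nonneg fun i _ => sq_nonneg (x i))
  refine ⟨?_, ?_⟩
  · simp only [lorentz, chartVec, Fin.snoc_castSucc, Fin.snoc_last]
    rw [Real.mul_self_sqrt h.le]
    simp only [pow_two]
    ring
  · simpa only [chartVec, Fin.snoc_last] using Real.sqrt_pos.mpr h

/-- The global smooth parametrization `x ↦ (x, √(1 + |x|²))` of `ℍⁿ` by `ℝⁿ`
(the hyperboloid sheet is the graph of a smooth function). -/
noncomputable def chart {n : ℕ} (x : Fin n → ℝ) : Hyp n := ⟨chartVec x, chartVec_mem x⟩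

/-- `u` is of class `C²` on the open set `U ⊆ ℍⁿ`. -/
def IsC2On {n : ℕ} (u : Hyp n → ℝ) (U : Set (Hyp n)) : Prop :=
  ContDiffOn ℝ 2 (fun x => u (chart x)) (chart ⁻¹' U)

/-! ### Hypersurfaces of `ℍⁿ × ℝ` with the Lorentzian metric `g_ℍ - dt²`

The space-time `ℍⁿ × ℝ` is contained in `ℝⁿ⁺¹ × ℝ` with the flat indefinite form `ambForm`, which
induces the metric `g_ℍ - dt²`; its Levi-Civita connection is the tangential part of the flat
connection of `ℝⁿ⁺¹ × ℝ`. -/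

/-- The ambient vector space `ℝⁿ⁺¹ × ℝ`. -/
abbrev Amb (n : ℕ) : Type := (Fin (n + 1) → ℝ) × ℝ

/-- The flat form `⟨X, Y⟩ - ab` for `(X, a), (Y, b)`. -/
def ambForm {n : ℕ} (X Y : Amb n) : ℝ := lorentz X.1 Y.1 - X.2 * Y.2

/-- The parallel vector field `∂ₜ`. -/
def dt (n : ℕ) : Amb n := (0, 1)

/-- `i`-th coordinate vector field `∂ᵢF` of a parametrized hypersurface `F`. -/
noncomputable def partialD {n : ℕ} (F : (Fin n → ℝ) → Amb n) (i : Fin n) (x : Fin n → ℝ) :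
    Amb n :=
  fderiv ℝ F x (Pi.single i 1)

/-- Matrix of the induced metric (first fundamental form) of `F` at `x`. -/
noncomputable def gram {n : ℕ} (F : (Fin n → ℝ) → Amb n) (x : Fin n → ℝ) :
    Matrix (Fin n) (Fin n) ℝ :=
  Matrix.of fun i j => ambForm (partialD F i x) (partialD F j x)

/-- Normal space at `x` of a hypersurface `F` of `ℍⁿ × ℝ`: vectors tangent to `ℍⁿ × ℝ` at `F x`
(first condition) and orthogonal to the hypersurface (second condition). -/
def normalSpace {n : ℕ} (F : (Fin n → ℝ) → Amb n) (x : Fin n → ℝ) : Set (Amb n) :=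
  {ξ | lorentz ξ.1 (F x).1 = 0 ∧ ∀ i, ambForm ξ (partialD F i x) = 0}

/-- `ξ = Z^⊥`: the vector `ξ` is the orthogonal projection of `Z` to the normal space. -/
def IsNormalPart {n : ℕ} (F : (Fin n → ℝ) → Amb n) (x : Fin n → ℝ) (Z ξ : Amb n) : Prop :=
  ξ ∈ normalSpace F x ∧ ∀ η ∈ normalSpace F x, ambForm (Z - ξ) η = 0

/-- `H` is the mean curvature vector of `F` in `ℍⁿ × ℝ` at `x`, i.e. the trace with respect to the
induced metric of the second fundamental form `II(∂ᵢ, ∂ⱼ) = (∂ᵢ∂ⱼF)^⊥`. -/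
def IsMeanCurvatureVector {n : ℕ} (F : (Fin n → ℝ) → Amb n) (x : Fin n → ℝ) (H : Amb n) : Prop :=
  IsNormalPart F x (∑ i, ∑ j, (gram F x)⁻¹ i j • partialD (partialD F j) i x) H

/-- The graph map `p ↦ (p, u p)`, in the global chart. -/
noncomputable def graphMap {n : ℕ} (u : Hyp n → ℝ) (x : Fin n → ℝ) : Amb n :=
  ((chart x).1, u (chart x))

/-- The graph `Γ_u` over the open set `U ⊆ ℍⁿ` is a space-like translator: `u` is `C²` on `U`, the
metric induced on the graph is positive definite, and the mean curvature vector is `H = ∂ₜ^⊥`. -/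
def IsSpacelikeTranslatorOn {n : ℕ} (u : Hyp n → ℝ) (U : Set (Hyp n)) : Prop :=
  IsC2On u U ∧
  ∀ x : Fin n → ℝ, chart x ∈ U →
    (gram (graphMap u) x).PosDef ∧
    ∃ H : Amb n, IsMeanCurvatureVector (graphMap u) x H ∧ IsNormalPart (graphMap u) x (dt n) H

/-! ### Rotational invariance and the bowl -/

/-- The graph of `u` over `A`, as a subset of `ℍⁿ × ℝ`. -/
def graphOver {n : ℕ} (u : Hyp n → ℝ) (A : Set (Hyp n)) : Set (Hyp n × ℝ) :=
  {P | P.1 ∈ A ∧ P.2 = u P.1}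

/-- `S ⊆ ℍⁿ × ℝ` is rotationally invariant about the axis `{c} × ℝ`: it is invariant under
`σ × id` for every isometry `σ` of `ℍⁿ` that fixes `c`. -/
def RotationallyInvariant {n : ℕ} (c : Hyp n) (S : Set (Hyp n × ℝ)) : Prop :=
  ∀ σ : Hyp n ≃ Hyp n, (∀ p q, hdist (σ p) (σ q) = hdist p q) → σ c = c →
    Prod.map σ id '' S = S

/-- `f : [0, ∞) → ℝ` is a profile of the bowl: `f` is a primitive of the solution
`w : [0, ∞) → (-1, 1)` of `w' = (1 - w²)(1 - (n - 1) coth(s) w)` with `w(0) = 0`. -/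
def IsBowlProfile (n : ℕ) (f : ℝ → ℝ) : Prop :=
  ∃ w : ℝ → ℝ, ContinuousOn w (Set.Ici 0) ∧ w 0 = 0 ∧ (∀ s, 0 ≤ s → |w s| < 1) ∧
    (∀ s, 0 < s → HasDerivAt w
      ((1 - w s ^ 2) * (1 - ((n : ℝ) - 1) * (Real.cosh s / Real.sinh s) * w s)) s) ∧
    ∀ s, 0 ≤ s → HasDerivWithinAt f (w s) (Set.Ici 0) s

/-- The bowl with axis `{c} × ℝ` and profile `f`: the entire graph of `p ↦ f(d(p, c))`. -/
def bowl {n : ℕ} (c : Hyp n) (f : ℝ → ℝ) : Set (Hyp n × ℝ) :=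
  {P | P.2 = f (hdist P.1 c)}

end HESU

/-! Composing the chart x ↦ (x, √(1+|x|²)) with the Lorentz reflection that swaps `c` and the base
point gives coordinates in which `c` is the origin, |x| = sinh d(·, c), and orthogonal maps are
isometries. Pairing H = ∂ₜ^⊥ with the normal vector (∇u, 1) yields a scalar quasilinear equation,
`SolvesAt`, which does not involve the value of u, is elliptic where |∇u| < 1, and is invariant
under O(n) (`solvesAt_of_translator`, `SolvesAt.comp_mulVec`).

Symmetry. For orthogonal O, both f and f ∘ O solve this equation on the punctured ball, with the
same boundary values. Being space-like bounds the gradient, and for n ≥ 2 any two points near the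
puncture are joined by a short path missing it, so the oscillation of f over shrinking punctured
balls tends to 0 (`abs_sub_le_near_puncture`). Hence f - f ∘ O tends to 0 at the puncture, where it
also vanishes because O fixes 0. The puncture is then one more boundary point with zero data, and no
removable-singularity theorem is needed: `comparison`, used in both directions, gives f = f ∘ O.
Reflections carry any vector to any other of the same length, so f is radial (`radial_of_solves`).

Bowl. If u is C² at `c` too, restrict f to the unit-speed geodesic s ↦ sinh(s) eᵢ. The derivative w
of the restriction solves the profile equation (`profile_ode`), and w(0) = 0 because the restriction
is even. The substitution w = tanh θ makes the equation bounded and Lipschitz in θ on compact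
intervals of s > 0, so w continues past r to all s (`extend_profile`), and its primitive is the
profile. The singular point s = 0 calls for no existence theory, since u itself supplies the
solution there. -/

namespace HESU

/-! ### Gradients, Hessians and the second order chain rule -/

open scoped Matrix

/-- Euclidean gradient. -/
noncomputable def grad {n : ℕ} (f : (Fin n → ℝ) → ℝ) (x : Fin n → ℝ) : Fin n → ℝ :=
  fun i => fderiv ℝ f x (Pi.single i 1)

/-- Euclidean Hessian. -/
noncomputable def hess {n : ℕ} (f : (Fin n → ℝ) → ℝ) (x : Fin n → ℝ) : Matrix (Fin n) (Fin n) ℝ :=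
  Matrix.of fun i j => fderiv ℝ (fun y => fderiv ℝ f y (Pi.single j 1)) x (Pi.single i 1)

theorem clm_apply_eq_dotProduct {n : ℕ} (T : (Fin n → ℝ) →L[ℝ] ℝ) (v : Fin n → ℝ) :
    T v = (fun i => T (Pi.single i 1)) ⬝ᵥ v := by
  have h : v = ∑ i, v i • (Pi.single i 1 : Fin n → ℝ) := by
    ext j; simp [Finset.sum_apply, Pi.single_apply]
  conv_lhs => rw [h]
  simp [dotProduct, mul_comm]

theorem fderiv_eq_grad {n : ℕ} (f : (Fin n → ℝ) → ℝ) (x v : Fin n → ℝ) :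
    fderiv ℝ f x v = grad f x ⬝ᵥ v := clm_apply_eq_dotProduct _ v

theorem contDiffAt_fderiv_apply {E F : Type*} [NormedAddCommGroup E] [NormedSpace ℝ E]
    [NormedAddCommGroup F] [NormedSpace ℝ F] {f : E → F} {x : E} (hf : ContDiffAt ℝ 2 f x) (v : E) :
    ContDiffAt ℝ 1 (fun y => fderiv ℝ f y v) x :=
  (hf.fderiv_right (m := 1) (by norm_num)).clm_apply contDiffAt_const

theorem eventually_contDiffAt_two {E F : Type*} [NormedAddCommGroup E] [NormedSpace ℝ E]
    [NormedAddCommGroup F] [NormedSpace ℝ F] {f : E → F} {x : E} (hf : ContDiffAt ℝ 2 f x) :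
    ∀ᶠ y in nhds x, ContDiffAt ℝ 2 f y := hf.eventually (by simp)

theorem contDiffAt_grad {n : ℕ} {f : (Fin n → ℝ) → ℝ} {x : Fin n → ℝ} (hf : ContDiffAt ℝ 2 f x) :
    ContDiffAt ℝ 1 (grad f) x :=
  contDiffAt_pi.2 fun _ => contDiffAt_fderiv_apply hf _

theorem continuousAt_hess {n : ℕ} {f : (Fin n → ℝ) → ℝ} {x : Fin n → ℝ}
    (hf : ContDiffAt ℝ 2 f x) : ContinuousAt (hess f) x := by
  refine continuousAt_pi.2 fun i => continuousAt_pi.2 fun j => ?_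
  exact (((contDiffAt_fderiv_apply hf (Pi.single j 1)).fderiv_right (m := 0) (by norm_num)).clm_apply
    contDiffAt_const).continuousAt

/-- The vector multiplies on the left because the row index of `hess` is the outer derivative; with
this order the symmetry of second derivatives is never invoked. -/
theorem fderiv_grad_apply {n : ℕ} {f : (Fin n → ℝ) → ℝ} {x : Fin n → ℝ}
    (hf : ContDiffAt ℝ 2 f x) (v : Fin n → ℝ) : fderiv ℝ (grad f) x v = v ᵥ* hess f x := by
  ext j
  have h : HasFDerivAt (grad f) (fderiv ℝ (grad f) x) x :=
    ((contDiffAt_grad hf).differentiableAt (by simp)).hasFDerivAt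
  have h2 := (hasFDerivAt_pi'.1 h j).fderiv
  have h3 : fderiv ℝ (grad f) x v j = fderiv ℝ (fun y => grad f y j) x v := by rw [h2]; rfl
  rw [h3, fderiv_eq_grad, dotProduct_comm]
  rfl

theorem fderiv_comp_grad {E : Type*} [NormedAddCommGroup E] [NormedSpace ℝ E] {n : ℕ}
    {f : (Fin n → ℝ) → ℝ} {ψ : E → Fin n → ℝ} {x : E} (hf : DifferentiableAt ℝ f (ψ x))
    (hψ : DifferentiableAt ℝ ψ x) (v : E) :
    fderiv ℝ (fun y => f (ψ y)) x v = grad f (ψ x) ⬝ᵥ fderiv ℝ ψ x v := by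
  rw [← fderiv_eq_grad]
  have := (hf.hasFDerivAt.comp x hψ.hasFDerivAt).fderiv
  rw [show (fun y => f (ψ y)) = f ∘ ψ from rfl, this]
  rfl

theorem hasFDerivAt_dotProduct {E : Type*} [NormedAddCommGroup E] [NormedSpace ℝ E] {n : ℕ}
    {a b : E → Fin n → ℝ} {x : E} (ha : DifferentiableAt ℝ a x) (hb : DifferentiableAt ℝ b x)
    (v : E) : fderiv ℝ (fun y => a y ⬝ᵥ b y) x v
      = fderiv ℝ a x v ⬝ᵥ b x + a x ⬝ᵥ fderiv ℝ b x v := by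
  have ha' := fun i => hasFDerivAt_pi'.1 ha.hasFDerivAt i
  have hb' := fun i => hasFDerivAt_pi'.1 hb.hasFDerivAt i
  have : HasFDerivAt (fun y => a y ⬝ᵥ b y) _ x :=
    HasFDerivAt.fun_sum (u := Finset.univ) fun i _ => (ha' i).mul (hb' i)
  rw [this.fderiv]
  simp [dotProduct, Finset.sum_add_distrib, mul_comm, add_comm]

/-- Second order chain rule. -/
theorem fderiv_fderiv_comp {E : Type*} [NormedAddCommGroup E] [NormedSpace ℝ E] {n : ℕ}
    {f : (Fin n → ℝ) → ℝ} {ψ : E → Fin n → ℝ} {x : E} (hf : ContDiffAt ℝ 2 f (ψ x))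
    (hψ : ContDiffAt ℝ 2 ψ x) (v w : E) :
    fderiv ℝ (fun y => fderiv ℝ (fun z => f (ψ z)) y w) x v =
      fderiv ℝ ψ x v ⬝ᵥ hess f (ψ x) *ᵥ fderiv ℝ ψ x w +
        grad f (ψ x) ⬝ᵥ fderiv ℝ (fun y => fderiv ℝ ψ y w) x v := by
  have h1 : (fun y => fderiv ℝ (fun z => f (ψ z)) y w) =ᶠ[nhds x]
      fun y => grad f (ψ y) ⬝ᵥ fderiv ℝ ψ y w := by
    filter_upwards [hψ.continuousAt.eventually (eventually_contDiffAt_two hf),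
      eventually_contDiffAt_two hψ] with y h1 h2
    exact fderiv_comp_grad (h1.differentiableAt (by simp)) (h2.differentiableAt (by simp)) w
  have dψ := hψ.differentiableAt (by simp)
  have dg := (contDiffAt_grad hf).differentiableAt (by simp)
  rw [h1.fderiv_eq, hasFDerivAt_dotProduct (a := fun y => grad f (ψ y)) (dg.comp x dψ)
    ((contDiffAt_fderiv_apply hψ w).differentiableAt (by simp))]
  have h2 : fderiv ℝ (fun y => grad f (ψ y)) x v = fderiv ℝ (grad f) (ψ x) (fderiv ℝ ψ x v) := by
    rw [show (fun y => grad f (ψ y)) = grad f ∘ ψ from rfl, fderiv_comp x dg dψ]; rfl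
  rw [h2, fderiv_grad_apply hf, Matrix.dotProduct_mulVec]

/-! ### The translator equation in coordinates -/

/-- The squared norm of the differential `G` at `x`, for the hyperbolic metric in the chart. -/
def conormSq {n : ℕ} (x G : Fin n → ℝ) : ℝ := G ⬝ᵥ G + (G ⬝ᵥ x) ^ 2

/-- The hyperbolic gradient with differential `G` at `x`. -/
def raise {n : ℕ} (x G : Fin n → ℝ) : Fin n → ℝ := G + (G ⬝ᵥ x) • x

/-- The translator operator in the chart, as a function of point, gradient and Hessian. -/
def translatorOp {n : ℕ} (x G : Fin n → ℝ) (A : Matrix (Fin n) (Fin n) ℝ) : ℝ :=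
  (1 - conormSq x G) * (A.trace + x ⬝ᵥ A *ᵥ x + n * (G ⬝ᵥ x) - 1) +
    raise x G ⬝ᵥ A *ᵥ raise x G + conormSq x G * (G ⬝ᵥ x)

/-- `f` is space-like and solves the translator equation at `x`, in the chart. -/
def SolvesAt {n : ℕ} (f : (Fin n → ℝ) → ℝ) (x : Fin n → ℝ) : Prop :=
  conormSq x (grad f x) < 1 ∧ translatorOp x (grad f x) (hess f x) = 0

/-- The hyperbolic metric in the chart. -/
noncomputable def hypMetric {n : ℕ} (z : Fin n → ℝ) : Matrix (Fin n) (Fin n) ℝ :=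
  1 - (1 + z ⬝ᵥ z)⁻¹ • Matrix.vecMulVec z z

theorem one_add_dotProduct_self_pos {n : ℕ} (z : Fin n → ℝ) : 0 < 1 + z ⬝ᵥ z :=
  add_pos_of_pos_of_nonneg one_pos (Finset.sum_nonneg fun _ _ => mul_self_nonneg _)

theorem vecMulVec_mul_vecMulVec_eq_smul {n : ℕ} (a b c d : Fin n → ℝ) :
    Matrix.vecMulVec a b * Matrix.vecMulVec c d = (b ⬝ᵥ c) • Matrix.vecMulVec a d := by
  rw [Matrix.vecMulVec_mul_vecMulVec, Matrix.vecMulVec_smul]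

theorem raise_mulVec {n : ℕ} (z G : Fin n → ℝ) : hypMetric z *ᵥ raise z G = G := by
  have h := (one_add_dotProduct_self_pos z).ne'
  ext i
  simp only [hypMetric, raise, Matrix.sub_mulVec, Matrix.one_mulVec, Matrix.smul_mulVec,
    Matrix.vecMulVec_mulVec, dotProduct_add, dotProduct_smul, Pi.sub_apply, Pi.add_apply,
    Pi.smul_apply, smul_eq_mul, MulOpposite.smul_eq_mul_unop, MulOpposite.unop_op,
    dotProduct_comm z G]
  field_simp
  ring

theorem dotProduct_raise {n : ℕ} (z G : Fin n → ℝ) : G ⬝ᵥ raise z G = conormSq z G := by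
  simp only [raise, conormSq, dotProduct_add, dotProduct_smul, smul_eq_mul]; ring

theorem hypMetric_mul_inverse {n : ℕ} (z : Fin n → ℝ) :
    hypMetric z * (1 + Matrix.vecMulVec z z) = 1 := by
  have h := (one_add_dotProduct_self_pos z).ne'
  have h2 : Matrix.vecMulVec z z * Matrix.vecMulVec z z = (z ⬝ᵥ z) • Matrix.vecMulVec z z :=
    vecMulVec_mul_vecMulVec_eq_smul z z z z
  rw [hypMetric, sub_mul, mul_add, mul_add, one_mul, one_mul, mul_one, Matrix.smul_mul, h2]
  ext i j
  simp only [Matrix.sub_apply, Matrix.add_apply, Matrix.smul_apply, smul_eq_mul]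
  field_simp
  ring

/-- The cofactor-type matrix of the induced metric. -/
def inducedCofactor {n : ℕ} (z G : Fin n → ℝ) : Matrix (Fin n) (Fin n) ℝ :=
  (1 - conormSq z G) • (1 + Matrix.vecMulVec z z) + Matrix.vecMulVec (raise z G) (raise z G)

/-- Sherman–Morrison for the rank-one perturbation g - GGᵀ of the hyperbolic metric, cleared of the
denominator 1 - |G|². -/
theorem induced_mul_cofactor {n : ℕ} (z G : Fin n → ℝ) :
    (hypMetric z - Matrix.vecMulVec G G) * inducedCofactor z G =
      (1 - conormSq z G) • (1 : Matrix (Fin n) (Fin n) ℝ) := by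
  have h1 : Matrix.vecMulVec G G * (1 + Matrix.vecMulVec z z) = Matrix.vecMulVec G (raise z G) := by
    rw [mul_add, mul_one, Matrix.vecMulVec_mul_vecMulVec]
    ext i j; simp [Matrix.vecMulVec_apply, raise]; ring
  have h2 : hypMetric z * Matrix.vecMulVec (raise z G) (raise z G)
      = Matrix.vecMulVec G (raise z G) := by
    rw [Matrix.mul_vecMulVec, raise_mulVec]
  have h3 : Matrix.vecMulVec G G * Matrix.vecMulVec (raise z G) (raise z G)
      = conormSq z G • Matrix.vecMulVec G (raise z G) := by
    rw [vecMulVec_mul_vecMulVec_eq_smul, dotProduct_raise]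
  rw [inducedCofactor, sub_mul, mul_add, mul_add, Matrix.mul_smul, Matrix.mul_smul,
    hypMetric_mul_inverse, h1, h2, h3, sub_smul]
  module

theorem trace_vecMulVec_mul {n : ℕ} (a b : Fin n → ℝ) (A : Matrix (Fin n) (Fin n) ℝ) :
    (Matrix.vecMulVec a b * A).trace = b ⬝ᵥ A *ᵥ a := by
  rw [Matrix.vecMulVec_mul, Matrix.trace_vecMulVec, dotProduct_comm, Matrix.dotProduct_mulVec]

/-- The trace form of the translator equation, in an arbitrary frame `P`, is the equation in the
chart. -/
theorem translatorOp_of_trace {n : ℕ} (P A : Matrix (Fin n) (Fin n) ℝ) (z G : Fin n → ℝ)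
    (hpos : (P * (hypMetric z - Matrix.vecMulVec G G) * Pᵀ).PosDef)
    (htr : ∑ i, ∑ j, (P * (hypMetric z - Matrix.vecMulVec G G) * Pᵀ)⁻¹ i j *
      (P * (A + (G ⬝ᵥ z) • hypMetric z) * Pᵀ) i j = 1) :
    conormSq z G < 1 ∧ translatorOp z G A = 0 := by
  set M := hypMetric z - Matrix.vecMulVec G G with hM
  set C := A + (G ⬝ᵥ z) • hypMetric z with hC
  have hdet : (P * M * Pᵀ).det ≠ 0 := hpos.isUnit.map Matrix.detMonoidHom |>.ne_zero
  have hP : P.det ≠ 0 := by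
    intro h; apply hdet; simp [Matrix.det_mul, h]
  have hPt : Pᵀ.det ≠ 0 := by rwa [Matrix.det_transpose]
  have hPu : IsUnit P.det := isUnit_iff_ne_zero.2 hP
  have hPtu : IsUnit Pᵀ.det := isUnit_iff_ne_zero.2 hPt
  have hMd : IsUnit M.det := by
    refine isUnit_iff_ne_zero.2 fun h => hdet ?_
    simp [Matrix.det_mul, h]
  -- Test positive definiteness on the hyperbolic gradient q: with N = |G|² one gets qᵀ(g - GGᵀ)q =
  -- N - N² > 0, unless q = 0 and then N = 0.
  have hN : conormSq z G < 1 := by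
    by_cases hq : raise z G = 0
    · have : conormSq z G = 0 := by rw [← dotProduct_raise, hq, dotProduct_zero]
      rw [this]; exact one_pos
    · have h1 : Pᵀ *ᵥ (Pᵀ⁻¹ *ᵥ raise z G) = raise z G := by
        rw [Matrix.mulVec_mulVec, Matrix.mul_nonsing_inv _ hPtu, Matrix.one_mulVec]
      have h0 : Pᵀ⁻¹ *ᵥ raise z G ≠ 0 := by
        intro h; rw [h, Matrix.mulVec_zero] at h1; exact hq h1.symm
      have h2 := hpos.dotProduct_mulVec_pos h0
      rw [star_trivial, ← Matrix.mulVec_mulVec, h1, ← Matrix.mulVec_mulVec,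
        Matrix.dotProduct_mulVec, ← Matrix.mulVec_transpose, h1, hM, Matrix.sub_mulVec,
        raise_mulVec, Matrix.vecMulVec_mulVec, dotProduct_raise, dotProduct_sub,
        dotProduct_comm _ G, dotProduct_raise] at h2
      simp only [dotProduct_smul, dotProduct_comm _ G, dotProduct_raise] at h2
      simp only [MulOpposite.smul_eq_mul_unop, MulOpposite.unop_op] at h2
      by_contra hcon
      nlinarith
  refine ⟨hN, ?_⟩
  -- The double sum pairs equal entries of the two matrices, whereas the trace of a product pairs
  -- transposed ones.
  have hsymm : (P * M * Pᵀ)⁻¹ᵀ = (P * M * Pᵀ)⁻¹ := by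
    rw [Matrix.transpose_nonsing_inv]
    congr 1
    have := hpos.isHermitian
    rwa [Matrix.IsHermitian, Matrix.conjTranspose_eq_transpose_of_trivial] at this
  have htr2 : ((P * M * Pᵀ)⁻¹ * (P * C * Pᵀ)).trace = 1 := by
    have h : ∀ Y X : Matrix (Fin n) (Fin n) ℝ, (Y * X).trace = ∑ i, ∑ j, Yᵀ i j * X i j := by
      intro Y X
      rw [Finset.sum_comm]
      simp [Matrix.trace, Matrix.mul_apply]
    rw [h, hsymm, htr]
  -- The trace of one bilinear form with respect to another does not depend on the frame, so P
  -- cancels.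
  have htr3 : (M⁻¹ * C).trace = 1 := by
    rw [← htr2, Matrix.mul_inv_rev, Matrix.mul_inv_rev,
      show Pᵀ⁻¹ * (M⁻¹ * P⁻¹) * (P * C * Pᵀ) = Pᵀ⁻¹ * (M⁻¹ * ((P⁻¹ * P) * C) * Pᵀ) by
        simp only [mul_assoc],
      Matrix.nonsing_inv_mul _ hPu, one_mul, Matrix.trace_mul_comm Pᵀ⁻¹, mul_assoc,
      Matrix.mul_nonsing_inv _ hPtu, mul_one]
  have hK : inducedCofactor z G = (1 - conormSq z G) • M⁻¹ := by
    have := congrArg (M⁻¹ * ·) (induced_mul_cofactor z G)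
    simp only [← hM, ← mul_assoc, Matrix.nonsing_inv_mul _ hMd, one_mul, Matrix.mul_smul,
      mul_one] at this
    exact this
  have h5 : (inducedCofactor z G * C).trace = 1 - conormSq z G := by
    rw [hK, Matrix.smul_mul, Matrix.trace_smul, htr3, smul_eq_mul, mul_one]
  have h6 : (1 + Matrix.vecMulVec z z) * hypMetric z = 1 :=
    mul_eq_one_comm.1 (hypMetric_mul_inverse z)
  have h7 : (inducedCofactor z G * hypMetric z).trace = (1 - conormSq z G) * n + conormSq z G := by
    rw [inducedCofactor, add_mul, Matrix.smul_mul, h6, Matrix.trace_add, trace_vecMulVec_mul,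
      raise_mulVec, dotProduct_comm, dotProduct_raise]
    simp
  have h8 : (inducedCofactor z G * A).trace
      = (1 - conormSq z G) * (A.trace + z ⬝ᵥ A *ᵥ z) + raise z G ⬝ᵥ A *ᵥ raise z G := by
    rw [inducedCofactor, add_mul, Matrix.smul_mul, add_mul, one_mul, Matrix.trace_add,
      trace_vecMulVec_mul, Matrix.trace_smul, Matrix.trace_add, trace_vecMulVec_mul, smul_eq_mul]
  rw [hC, mul_add, Matrix.mul_smul, Matrix.trace_add, Matrix.trace_smul, h7, h8, smul_eq_mul] at h5
  rw [translatorOp]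
  linarith

/-! ### Lorentz reflections -/

theorem lorentz_eq {n : ℕ} (x y : Fin (n + 1) → ℝ) :
    lorentz x y = (fun i : Fin n => x i.castSucc) ⬝ᵥ (fun i : Fin n => y i.castSucc)
      - x (Fin.last n) * y (Fin.last n) := rfl

theorem lorentz_comm {n : ℕ} (x y : Fin (n + 1) → ℝ) : lorentz x y = lorentz y x := by
  simp only [lorentz, mul_comm]

theorem lorentz_add_left {n : ℕ} (x y z : Fin (n + 1) → ℝ) :
    lorentz (x + y) z = lorentz x z + lorentz y z := by
  simp only [lorentz, Pi.add_apply, add_mul, Finset.sum_add_distrib]; ring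

theorem lorentz_smul_left {n : ℕ} (a : ℝ) (x z : Fin (n + 1) → ℝ) :
    lorentz (a • x) z = a * lorentz x z := by
  simp only [lorentz, Pi.smul_apply, smul_eq_mul, mul_assoc, ← Finset.mul_sum, mul_sub]

theorem lorentz_add_right {n : ℕ} (x y z : Fin (n + 1) → ℝ) :
    lorentz x (y + z) = lorentz x y + lorentz x z := by
  rw [lorentz_comm, lorentz_add_left, lorentz_comm y, lorentz_comm z]

theorem lorentz_smul_right {n : ℕ} (a : ℝ) (x z : Fin (n + 1) → ℝ) :
    lorentz x (a • z) = a * lorentz x z := by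
  rw [lorentz_comm, lorentz_smul_left, lorentz_comm]

/-- The Lorentz form as a continuous bilinear map. -/
noncomputable def lorentzCLM (n : ℕ) : (Fin (n + 1) → ℝ) →L[ℝ] (Fin (n + 1) → ℝ) →L[ℝ] ℝ :=
  LinearMap.toContinuousLinearMap
    (LinearMap.toContinuousLinearMap.toLinearMap ∘ₗ
      LinearMap.mk₂ ℝ lorentz lorentz_add_left lorentz_smul_left lorentz_add_right
        lorentz_smul_right)

theorem lorentzCLM_apply {n : ℕ} (x y : Fin (n + 1) → ℝ) : lorentzCLM n x y = lorentz x y := rfl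

theorem lorentz_sub_left {n : ℕ} (x y z : Fin (n + 1) → ℝ) :
    lorentz (x - y) z = lorentz x z - lorentz y z := by
  simp only [← lorentzCLM_apply, map_sub, sub_apply]

theorem lorentz_sub_right {n : ℕ} (x y z : Fin (n + 1) → ℝ) :
    lorentz x (y - z) = lorentz x y - lorentz x z := by
  simp only [← lorentzCLM_apply, map_sub]

theorem fderiv_lorentz {E : Type*} [NormedAddCommGroup E] [NormedSpace ℝ E] {n : ℕ}
    {a b : E → Fin (n + 1) → ℝ} {x : E} (ha : DifferentiableAt ℝ a x)
    (hb : DifferentiableAt ℝ b x) (v : E) :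
    fderiv ℝ (fun y => lorentz (a y) (b y)) x v =
      lorentz (fderiv ℝ a x v) (b x) + lorentz (a x) (fderiv ℝ b x v) := by
  have := (lorentzCLM n).hasFDerivAt_of_bilinear ha.hasFDerivAt hb.hasFDerivAt
  have h2 : HasFDerivAt (fun y => lorentz (a y) (b y)) _ x := this
  rw [h2.fderiv]
  simp [lorentzCLM_apply, add_comm]

/-- Reflection in the hyperplane orthogonal to `m` (the identity if `m` is null). -/
noncomputable def lorentzRefl {n : ℕ} (m : Fin (n + 1) → ℝ) :
    (Fin (n + 1) → ℝ) →L[ℝ] (Fin (n + 1) → ℝ) :=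
  ContinuousLinearMap.id ℝ _ - ((2 / lorentz m m) • lorentzCLM n m).smulRight m

theorem lorentzRefl_apply {n : ℕ} (m Z : Fin (n + 1) → ℝ) :
    lorentzRefl m Z = Z - (2 / lorentz m m * lorentz m Z) • m := rfl

theorem lorentz_lorentzRefl {n : ℕ} (m Z W : Fin (n + 1) → ℝ) :
    lorentz (lorentzRefl m Z) (lorentzRefl m W) = lorentz Z W := by
  simp only [lorentzRefl_apply, lorentz_sub_left, lorentz_sub_right, lorentz_smul_left,
    lorentz_smul_right, lorentz_comm Z m]
  by_cases h : lorentz m m = 0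
  · simp [h]
  · field_simp; ring

theorem lorentzRefl_lorentzRefl {n : ℕ} (m Z : Fin (n + 1) → ℝ) :
    lorentzRefl m (lorentzRefl m Z) = Z := by
  by_cases h : lorentz m m = 0
  · simp [lorentzRefl_apply, h]
  · simp only [lorentzRefl_apply, lorentz_sub_right, lorentz_smul_right]
    have : 2 / lorentz m m * (lorentz m Z - 2 / lorentz m m * lorentz m Z * lorentz m m)
        = -(2 / lorentz m m * lorentz m Z) := by field_simp; ring
    rw [this]; module

/-- By Cauchy–Schwarz, vectors on opposite sheets have positive Lorentz product. This keeps the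
reflection at `c` on the upper sheet. -/
theorem last_pos_of_lorentz_neg {n : ℕ} {Y : Fin (n + 1) → ℝ} (hY : lorentz Y Y = -1) (c : Hyp n)
    (h : lorentz Y c.1 < 0) : 0 < Y (Fin.last n) := by
  obtain ⟨c, hc, hc0⟩ := c
  simp only at h
  by_contra hn
  push Not at hn
  have cs := Finset.sum_mul_sq_le_sq_mul_sq Finset.univ (fun i : Fin n => Y i.castSucc)
    (fun i : Fin n => c i.castSucc)
  simp only [lorentz, ← pow_two] at hY hc h
  have h1 : ∑ i : Fin n, Y i.castSucc ^ 2 = Y (Fin.last n) ^ 2 - 1 := by linarith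
  have h2 : ∑ i : Fin n, c i.castSucc ^ 2 = c (Fin.last n) ^ 2 - 1 := by linarith
  have h3 : 0 ≤ c (Fin.last n) ^ 2 - 1 := h2 ▸ Finset.sum_nonneg fun i _ => sq_nonneg _
  rw [h1, h2] at cs
  set S := ∑ i : Fin n, Y i.castSucc * c i.castSucc
  have h4 : Y (Fin.last n) * c (Fin.last n) ≤ 0 := mul_nonpos_of_nonpos_of_nonneg hn hc0.le
  nlinarith [sq_nonneg (Y (Fin.last n))]

/-! ### The chart centred at `c` -/

theorem chartVec_castSucc {n : ℕ} (x : Fin n → ℝ) (i : Fin n) : chartVec x i.castSucc = x i := by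
  simp [chartVec]

theorem chartVec_last {n : ℕ} (x : Fin n → ℝ) :
    chartVec x (Fin.last n) = Real.sqrt (1 + x ⬝ᵥ x) := by
  simp [chartVec, dotProduct, pow_two]

theorem chartVec_init {n : ℕ} {Y : Fin (n + 1) → ℝ} (hY : lorentz Y Y = -1)
    (h0 : 0 < Y (Fin.last n)) : chartVec (fun i => Y i.castSucc) = Y := by
  ext i
  refine Fin.lastCases ?_ (fun i => ?_) i
  · rw [chartVec_last, Real.sqrt_eq_iff_mul_self_eq_of_pos h0]
    rw [lorentz_eq] at hY; linarith
  · simp [chartVec_castSucc]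

theorem chart_init {n : ℕ} (p : Hyp n) : chart (fun i => p.1 i.castSucc) = p :=
  Subtype.ext (chartVec_init p.2.1 p.2.2)

theorem contDiff_chartVec {n : ℕ} {k : WithTop ℕ∞} :
    ContDiff ℝ k (chartVec : (Fin n → ℝ) → Fin (n + 1) → ℝ) := by
  refine contDiff_pi.2 fun i => ?_
  refine Fin.lastCases ?_ (fun i => ?_) i
  · simp only [chartVec_last, dotProduct]
    refine ContDiff.sqrt (by fun_prop) fun x => (one_add_dotProduct_self_pos x).ne'
  · simp only [chartVec_castSucc]
    fun_prop

theorem continuous_chart {n : ℕ} : Continuous (chart : (Fin n → ℝ) → Hyp n) :=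
  (contDiff_chartVec (k := 0)).continuous.subtype_mk _

theorem lorentz_chartVec_zero {n : ℕ} (Y : Fin (n + 1) → ℝ) :
    lorentz (chartVec 0) Y = - Y (Fin.last n) := by
  simp [lorentz, chartVec_castSucc, chartVec_last]

/-- The Lorentz reflection exchanging `c` and the base point of the chart. -/
noncomputable def boost {n : ℕ} (c : Hyp n) : (Fin (n + 1) → ℝ) →L[ℝ] (Fin (n + 1) → ℝ) :=
  lorentzRefl (c.1 - chartVec 0)

theorem boost_base {n : ℕ} (c : Hyp n) : boost c (chartVec 0) = c.1 := by
  have h1 := lorentz_chartVec_zero c.1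
  have h2 := lorentz_chartVec_zero (chartVec (0 : Fin n → ℝ))
  have h4 : chartVec (0 : Fin n → ℝ) (Fin.last n) = 1 := by simp [chartVec_last]
  rw [h4] at h2
  have h3 := c.2.1
  have hm : lorentz (c.1 - chartVec 0) (c.1 - chartVec 0) = 2 * (c.1 (Fin.last n) - 1) := by
    simp only [lorentz_sub_left, lorentz_sub_right, lorentz_comm c.1 (chartVec 0), h1, h2, h3]
    ring
  have hm2 : lorentz (c.1 - chartVec 0) (chartVec 0) = -(c.1 (Fin.last n) - 1) := by
    rw [lorentz_sub_left, lorentz_comm c.1 (chartVec 0), h1, h2]; ring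
  rw [boost, lorentzRefl_apply, hm, hm2]
  -- Height 1 forces `c` to be the base point itself; the reflection vector is then 0 and the boost
  -- is the identity.
  by_cases h : c.1 (Fin.last n) - 1 = 0
  · have : c.1 = chartVec 0 := by
      have h5 : ∑ i : Fin n, c.1 i.castSucc ^ 2 = 0 := by
        simp only [lorentz, ← pow_two] at h3
        have : c.1 (Fin.last n) = 1 := by linarith
        rw [this] at h3; linarith
      rw [Finset.sum_eq_zero_iff_of_nonneg fun i _ => sq_nonneg _] at h5
      ext i
      refine Fin.lastCases ?_ (fun i => ?_) i
      · rw [h4]; linarith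
      · rw [chartVec_castSucc]
        exact pow_eq_zero_iff (two_ne_zero) |>.1 (h5 i (Finset.mem_univ _))
    rw [this]; simp
  · have : 2 / (2 * (c.1 (Fin.last n) - 1)) * -(c.1 (Fin.last n) - 1) = -1 := by field_simp
    rw [this]; module

theorem lorentz_boost {n : ℕ} (c : Hyp n) (Z W : Fin (n + 1) → ℝ) :
    lorentz (boost c Z) (boost c W) = lorentz Z W := lorentz_lorentzRefl _ _ _

theorem boost_boost {n : ℕ} (c : Hyp n) (Z : Fin (n + 1) → ℝ) : boost c (boost c Z) = Z :=
  lorentzRefl_lorentzRefl _ _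

theorem lorentz_boost_center {n : ℕ} (c : Hyp n) (Z : Fin (n + 1) → ℝ) :
    lorentz (boost c Z) c.1 = - Z (Fin.last n) := by
  rw [← boost_base, lorentz_boost, lorentz_comm, lorentz_chartVec_zero]

/-- The change between the chart and its composition with the boost at `c`. -/
noncomputable def recenter {n : ℕ} (c : Hyp n) (x : Fin n → ℝ) : Fin n → ℝ :=
  fun i => boost c (chartVec x) i.castSucc

theorem chartVec_recenter {n : ℕ} (c : Hyp n) (x : Fin n → ℝ) :
    chartVec (recenter c x) = boost c (chartVec x) := by
  have h1 : lorentz (boost c (chartVec x)) (boost c (chartVec x)) = -1 := by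
    rw [lorentz_boost]; exact (chartVec_mem x).1
  refine chartVec_init h1 (last_pos_of_lorentz_neg h1 c ?_)
  rw [lorentz_boost_center]
  linarith [(chartVec_mem x).2]

theorem recenter_recenter {n : ℕ} (c : Hyp n) (x : Fin n → ℝ) :
    recenter c (recenter c x) = x := by
  ext i
  rw [recenter, chartVec_recenter, boost_boost, chartVec_castSucc]

theorem contDiff_recenter {n : ℕ} {k : WithTop ℕ∞} (c : Hyp n) : ContDiff ℝ k (recenter c) :=
  contDiff_pi.2 fun i => contDiff_pi.1 ((boost c).contDiff.comp contDiff_chartVec) i.castSucc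

theorem recenter_zero {n : ℕ} (c : Hyp n) : chart (recenter c 0) = c :=
  Subtype.ext ((chartVec_recenter c 0).trans (boost_base c))

theorem exists_chart_recenter {n : ℕ} (c p : Hyp n) : ∃ x, chart (recenter c x) = p :=
  ⟨recenter c (fun i => p.1 i.castSucc), by rw [recenter_recenter, chart_init]⟩

theorem hdist_chart_recenter {n : ℕ} (c : Hyp n) (x : Fin n → ℝ) :
    hdist (chart (recenter c x)) c = Real.arcosh (Real.sqrt (1 + x ⬝ᵥ x)) := by
  rw [hdist]
  congr 1
  rw [show (chart (recenter c x)).1 = _ from chartVec_recenter c x, lorentz_boost_center,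
    chartVec_last, neg_neg]

/-! ### From the geometric definition to the equation in the chart -/

theorem ambForm_add_left {n : ℕ} (X Y Z : Amb n) :
    ambForm (X + Y) Z = ambForm X Z + ambForm Y Z := by
  simp only [ambForm, Prod.fst_add, Prod.snd_add, lorentz_add_left]; ring

theorem ambForm_smul_left {n : ℕ} (a : ℝ) (X Z : Amb n) :
    ambForm (a • X) Z = a * ambForm X Z := by
  simp only [ambForm, Prod.smul_fst, Prod.smul_snd, lorentz_smul_left, smul_eq_mul]; ring

theorem ambForm_sub_left {n : ℕ} (X Y Z : Amb n) :
    ambForm (X - Y) Z = ambForm X Z - ambForm Y Z := by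
  rw [sub_eq_add_neg, ambForm_add_left, show -Y = (-1 : ℝ) • Y by simp, ambForm_smul_left]; ring

theorem ambForm_sum_left {n : ℕ} {ι : Type*} (s : Finset ι) (X : ι → Amb n) (Z : Amb n) :
    ambForm (∑ i ∈ s, X i) Z = ∑ i ∈ s, ambForm (X i) Z := by
  let T : Amb n →+ ℝ := AddMonoidHom.mk' (fun X => ambForm X Z) fun X Y => ambForm_add_left X Y Z
  exact map_sum T X s

theorem partialD_prodMk {n : ℕ} {a : (Fin n → ℝ) → Fin (n + 1) → ℝ} {b : (Fin n → ℝ) → ℝ}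
    {x : Fin n → ℝ} (ha : DifferentiableAt ℝ a x) (hb : DifferentiableAt ℝ b x) (i : Fin n) :
    partialD (fun y => (a y, b y)) i x
      = (fderiv ℝ a x (Pi.single i 1), fderiv ℝ b x (Pi.single i 1)) := by
  rw [partialD, ha.fderiv_prodMk hb]; rfl

theorem lorentz_chartVec_fderiv {n : ℕ} (x v : Fin n → ℝ) :
    lorentz (chartVec x) (fderiv ℝ chartVec x v) = 0 := by
  have hd : DifferentiableAt ℝ (chartVec (n := n)) x :=
    (contDiff_chartVec (k := 1)).differentiable (by simp) x
  have h := fderiv_lorentz hd hd v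
  have h2 : (fun y : Fin n → ℝ => lorentz (chartVec y) (chartVec y)) = fun _ => -1 :=
    funext fun y => (chartVec_mem y).1
  rw [h2, lorentz_comm _ (chartVec x)] at h
  simp at h
  linarith

/-- Differentiate ⟨p, ∂p⟩ = 0 once more. This is the source of the Christoffel term (G·x) g in the
hyperbolic Hessian. -/
theorem lorentz_chartVec_fderiv_fderiv {n : ℕ} (x v w : Fin n → ℝ) :
    lorentz (chartVec x) (fderiv ℝ (fun y => fderiv ℝ chartVec y w) x v) =
      -lorentz (fderiv ℝ chartVec x v) (fderiv ℝ chartVec x w) := by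
  have hd : DifferentiableAt ℝ (chartVec (n := n)) x :=
    (contDiff_chartVec (k := 1)).differentiable (by simp) x
  have hd2 : DifferentiableAt ℝ (fun y : Fin n → ℝ => fderiv ℝ chartVec y w) x :=
    (contDiffAt_fderiv_apply contDiff_chartVec.contDiffAt w).differentiableAt (by simp)
  have h := fderiv_lorentz hd hd2 v
  have h2 : (fun y : Fin n → ℝ => lorentz (chartVec y) (fderiv ℝ chartVec y w)) = fun _ => 0 :=
    funext fun y => lorentz_chartVec_fderiv y w
  rw [h2] at h
  simp at h
  linarith

theorem fderiv_chartVec_castSucc {n : ℕ} (x v : Fin n → ℝ) (i : Fin n) :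
    fderiv ℝ chartVec x v i.castSucc = v i := by
  have hd : DifferentiableAt ℝ (chartVec (n := n)) x :=
    (contDiff_chartVec (k := 1)).differentiable (by simp) x
  have h := (hasFDerivAt_pi'.1 hd.hasFDerivAt i.castSucc).fderiv
  have h2 : (fun y : Fin n → ℝ => chartVec y i.castSucc) = fun y => y i :=
    funext fun y => chartVec_castSucc y i
  rw [h2, show (fun y : Fin n → ℝ => y i) =
    ContinuousLinearMap.proj (R := ℝ) (φ := fun _ : Fin n => ℝ) i from rfl,
    ContinuousLinearMap.fderiv] at h
  exact (congrArg (fun T => T v) h).symm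

/-- Orthogonality of ∂p to p determines the last component of the derivative, x·v/√(1+|x|²); its
square is the rank-one correction in the metric. -/
theorem lorentz_fderiv_chartVec {n : ℕ} (x v w : Fin n → ℝ) :
    lorentz (fderiv ℝ chartVec x v) (fderiv ℝ chartVec x w) = v ⬝ᵥ hypMetric x *ᵥ w := by
  have hs := one_add_dotProduct_self_pos x
  have h : ∀ v, x ⬝ᵥ v = Real.sqrt (1 + x ⬝ᵥ x) * fderiv ℝ chartVec x v (Fin.last n) := by
    intro v
    have := lorentz_chartVec_fderiv x v
    rw [lorentz_eq, chartVec_last] at this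
    simp only [chartVec_castSucc, fderiv_chartVec_castSucc] at this
    linarith
  rw [lorentz_eq]
  simp only [fderiv_chartVec_castSucc, hypMetric, Matrix.sub_mulVec, Matrix.one_mulVec,
    Matrix.smul_mulVec, Matrix.vecMulVec_mulVec, dotProduct_sub, dotProduct_smul, smul_eq_mul,
    MulOpposite.smul_eq_mul_unop, MulOpposite.unop_op]
  rw [dotProduct_comm v x, h v, h w]
  have h3 := Real.mul_self_sqrt hs.le
  generalize Real.sqrt (1 + x ⬝ᵥ x) = s at *
  rw [← h3] at hs ⊢
  have : s ≠ 0 := by rintro rfl; simp at hs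
  field_simp

theorem fderiv_clm_comp_fderiv {E F G : Type*} [NormedAddCommGroup E] [NormedSpace ℝ E]
    [NormedAddCommGroup F] [NormedSpace ℝ F] [NormedAddCommGroup G] [NormedSpace ℝ G]
    (T : F →L[ℝ] G) {a : E → F} {x : E} (ha : DifferentiableAt ℝ a x) (v : E) :
    fderiv ℝ (fun y => T (a y)) x v = T (fderiv ℝ a x v) := by
  have := (T.hasFDerivAt.comp x ha.hasFDerivAt).fderiv
  rw [show (fun y => T (a y)) = T ∘ a from rfl, this]; rfl

/-- The boost at `c` followed by the projection to the first `n` coordinates. -/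
noncomputable def boostInit {n : ℕ} (c : Hyp n) : (Fin (n + 1) → ℝ) →L[ℝ] (Fin n → ℝ) :=
  (ContinuousLinearMap.pi fun i : Fin n =>
    ContinuousLinearMap.proj (R := ℝ) (φ := fun _ : Fin (n + 1) => ℝ) i.castSucc).comp (boost c)

theorem recenter_eq {n : ℕ} (c : Hyp n) :
    recenter c = fun x => boostInit c (chartVec x) := rfl

theorem fderiv_recenter {n : ℕ} (c : Hyp n) (x v : Fin n → ℝ) (i : Fin n) :
    fderiv ℝ (recenter c) x v i = boost c (fderiv ℝ chartVec x v) i.castSucc := by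
  have hd : DifferentiableAt ℝ (chartVec (n := n)) x :=
    (contDiff_chartVec (k := 1)).differentiable (by simp) x
  rw [recenter_eq, fderiv_clm_comp_fderiv _ hd]
  rfl

theorem fderiv_fderiv_recenter {n : ℕ} (c : Hyp n) (x v w : Fin n → ℝ) (i : Fin n) :
    fderiv ℝ (fun y => fderiv ℝ (recenter c) y w) x v i =
      boost c (fderiv ℝ (fun y => fderiv ℝ chartVec y w) x v) i.castSucc := by
  have hd2 : DifferentiableAt ℝ (fun y : Fin n → ℝ => fderiv ℝ chartVec y w) x :=
    (contDiffAt_fderiv_apply contDiff_chartVec.contDiffAt w).differentiableAt (by simp)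
  have h : (fun y => fderiv ℝ (recenter c) y w) = fun y =>
      boostInit c (fderiv ℝ chartVec y w) := by
    funext y; ext i; exact fderiv_recenter c y w i
  rw [h, fderiv_clm_comp_fderiv _ hd2]
  rfl

/-- The boost is linear and preserves the Lorentz form, so this makes `recenter` an isometry for the
chart metric. -/
theorem fderiv_chartVec_recenter {n : ℕ} (c : Hyp n) (x v : Fin n → ℝ) :
    fderiv ℝ chartVec (recenter c x) (fderiv ℝ (recenter c) x v) =
      boost c (fderiv ℝ chartVec x v) := by
  have hd : ∀ y, DifferentiableAt ℝ (chartVec (n := n)) y := fun y =>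
    (contDiff_chartVec (k := 1)).differentiable (by simp) y
  have hr : DifferentiableAt ℝ (recenter c) x :=
    (contDiff_recenter (k := 1) c).differentiable (by simp) x
  rw [← fderiv_clm_comp_fderiv _ (hd x), ← funext (chartVec_recenter c)]
  have := ((hd (recenter c x)).hasFDerivAt.comp x hr.hasFDerivAt).fderiv
  rw [show (fun y => chartVec (recenter c y)) = chartVec ∘ recenter c from rfl, this]
  rfl

/-- Geometric form of the translator equation implies the equation in the chart centred at `c`. -/
theorem solvesAt_of_translator {n : ℕ} (c : Hyp n) (u : Hyp n → ℝ) (x : Fin n → ℝ)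
    (hu : ContDiffAt ℝ 2 (fun y => u (chart y)) x) (hpos : (gram (graphMap u) x).PosDef)
    (htr : ∃ H : Amb n, IsMeanCurvatureVector (graphMap u) x H ∧
      IsNormalPart (graphMap u) x (dt n) H) :
    SolvesAt (fun y => u (chart (recenter c y))) (recenter c x) := by
  set f := fun y => u (chart (recenter c y)) with hf
  set z := recenter c x with hz
  set G := grad f z with hG
  set A := hess f z with hA
  set D := fun i : Fin n => fderiv ℝ (recenter c) x (Pi.single i 1) with hD
  set P : Matrix (Fin n) (Fin n) ℝ := Matrix.of D with hP
  have hfz : ContDiffAt ℝ 2 f z := by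
    have h : ContDiffAt ℝ 2 (fun y => u (chart y)) (recenter c z) := by
      rwa [hz, recenter_recenter]
    exact h.comp z (contDiff_recenter c).contDiffAt
  have hψ : ContDiffAt ℝ 2 (recenter c) x := (contDiff_recenter c).contDiffAt
  have hfu : (fun y => u (chart y)) = fun y => f (recenter c y) := by
    funext y; simp only [hf, recenter_recenter]
  have hcd : ∀ y, DifferentiableAt ℝ (chartVec (n := n)) y := fun y =>
    (contDiff_chartVec (k := 1)).differentiable (by simp) y
  have hp : ∀ i, ∀ᶠ y in nhds x, partialD (graphMap u) i y =
      (fderiv ℝ chartVec y (Pi.single i 1), fderiv ℝ (fun y => u (chart y)) y (Pi.single i 1)) := by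
    intro i
    filter_upwards [eventually_contDiffAt_two hu] with y hy
    exact partialD_prodMk (hcd y) (hy.differentiableAt (by simp)) i
  have hu1 : ∀ i, fderiv ℝ (fun y => u (chart y)) x (Pi.single i 1) = G ⬝ᵥ D i := by
    intro i
    rw [hfu, fderiv_comp_grad (hfz.differentiableAt (by simp)) (hψ.differentiableAt (by simp))]
  have hp1 : ∀ i, partialD (graphMap u) i x = (fderiv ℝ chartVec x (Pi.single i 1), G ⬝ᵥ D i) := by
    intro i
    rw [(hp i).self_of_nhds, hu1]
  have hp2 : ∀ i j, partialD (partialD (graphMap u) j) i x =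
      (fderiv ℝ (fun y => fderiv ℝ chartVec y (Pi.single j 1)) x (Pi.single i 1),
        D i ⬝ᵥ A *ᵥ D j + G ⬝ᵥ
          fderiv ℝ (fun y => fderiv ℝ (recenter c) y (Pi.single j 1)) x (Pi.single i 1)) := by
    intro i j
    rw [partialD, Filter.EventuallyEq.fderiv_eq (hp j)]
    have h := partialD_prodMk
      ((contDiffAt_fderiv_apply (contDiff_chartVec.contDiffAt (x := x))
        (Pi.single j 1)).differentiableAt (by simp))
      ((contDiffAt_fderiv_apply hu (Pi.single j 1)).differentiableAt (by simp)) i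
    rw [partialD] at h
    rw [h, hfu, fderiv_fderiv_comp hfz hψ]
  have hcc : ∀ v w, lorentz (fderiv ℝ chartVec x v) (fderiv ℝ chartVec x w) =
      fderiv ℝ (recenter c) x v ⬝ᵥ hypMetric z *ᵥ fderiv ℝ (recenter c) x w := by
    intro v w
    rw [← lorentz_boost c, ← fderiv_chartVec_recenter, ← fderiv_chartVec_recenter,
      lorentz_fderiv_chartVec]
  have hPMP : ∀ (S : Matrix (Fin n) (Fin n) ℝ) i j, (P * S * Pᵀ) i j = D i ⬝ᵥ S *ᵥ D j := by
    intro S i j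
    rw [mul_assoc, Matrix.mul_apply']
    congr 1
  have hgram : gram (graphMap u) x = P * (hypMetric z - Matrix.vecMulVec G G) * Pᵀ := by
    ext i j
    rw [hPMP, gram, Matrix.of_apply, hp1, hp1, ambForm, hcc, Matrix.sub_mulVec, dotProduct_sub,
      Matrix.vecMulVec_mulVec, dotProduct_smul, MulOpposite.smul_eq_mul_unop,
      MulOpposite.unop_op, dotProduct_comm G (D i)]
  set E : Fin (n + 1) → ℝ := Fin.snoc (α := fun _ => ℝ) G 0 with hE
  have hEl : ∀ Y : Fin (n + 1) → ℝ, lorentz E Y = G ⬝ᵥ fun i : Fin n => Y i.castSucc := by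
    intro Y; rw [lorentz_eq]; simp [hE]
  -- The normal (∇u, 1) of the graph: E represents the differential G, adding (G·z)p projects it to
  -- the tangent space of the hyperboloid at p (as ⟨p, p⟩ = -1), and the boost carries it back to
  -- the original position.
  set η : Amb n := (boost c (E + (G ⬝ᵥ z) • chartVec z), 1) with hη
  have hηl : ∀ Y : Fin (n + 1) → ℝ, lorentz η.1 Y =
      (G ⬝ᵥ fun i : Fin n => boost c Y i.castSucc) + (G ⬝ᵥ z) * lorentz (chartVec x) Y := by
    intro Y
    rw [hη, ← lorentz_boost c, boost_boost, lorentz_add_left, lorentz_smul_left, hEl, hz,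
      chartVec_recenter, lorentz_boost]
  have hηn : η ∈ normalSpace (graphMap u) x := by
    refine ⟨?_, fun i => ?_⟩
    · rw [hηl]
      have h1 : (fun i : Fin n => boost c (graphMap u x).1 i.castSucc) = z := rfl
      have h2 : lorentz (chartVec x) (graphMap u x).1 = -1 := (chartVec_mem x).1
      rw [h1, h2]; ring
    · rw [ambForm, hp1, hηl, lorentz_chartVec_fderiv, hη]
      have h1 : (fun k : Fin n => boost c (fderiv ℝ chartVec x (Pi.single i 1)) k.castSucc)
          = D i := funext fun k => (fderiv_recenter c x _ k).symm
      rw [h1]; ring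
  -- The second derivatives of `recenter` cancel between the two factors, leaving minus the
  -- hyperbolic Hessian A + (G·z) g in the frame P.
  have hηij : ∀ i j, ambForm (partialD (partialD (graphMap u) j) i x) η =
      -(P * (A + (G ⬝ᵥ z) • hypMetric z) * Pᵀ) i j := by
    intro i j
    rw [hp2, ambForm, lorentz_comm, hηl, lorentz_chartVec_fderiv_fderiv, hcc, hPMP]
    have h1 : (fun k : Fin n => boost c (fderiv ℝ (fun y => fderiv ℝ chartVec y (Pi.single j 1)) x
        (Pi.single i 1)) k.castSucc) = fderiv ℝ (fun y => fderiv ℝ (recenter c) y (Pi.single j 1)) x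
        (Pi.single i 1) := funext fun k => (fderiv_fderiv_recenter c x _ _ k).symm
    rw [h1, Matrix.add_mulVec, dotProduct_add, Matrix.smul_mulVec, dotProduct_smul, smul_eq_mul]
    simp only [hη, hD]
    ring
  -- Pairing both descriptions of H with the single normal η eliminates H and leaves the scalar
  -- equation.
  obtain ⟨H, ⟨-, h1⟩, -, h2⟩ := htr
  have h3 := h1 η hηn
  have h4 := h2 η hηn
  rw [ambForm_sub_left, ambForm_sum_left] at h3
  rw [ambForm_sub_left] at h4
  simp only [ambForm_sum_left, ambForm_smul_left, hηij, mul_neg, Finset.sum_neg_distrib] at h3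
  have h5 : ambForm (dt n) η = -1 := by simp [ambForm, dt, hη, lorentz]
  rw [hgram] at h3 hpos
  exact translatorOp_of_trace P A z G hpos (by linarith)

/-! ### Invariance under orthogonal maps -/

theorem fderiv_mulVec {n : ℕ} (O : Matrix (Fin n) (Fin n) ℝ) (x v : Fin n → ℝ) :
    fderiv ℝ (fun y => O *ᵥ y) x v = O *ᵥ v := by
  have := (LinearMap.toContinuousLinearMap (Matrix.mulVecLin O)).fderiv (x := x)
  exact congrArg (fun T => T v) this

theorem contDiff_mulVec {n : ℕ} (O : Matrix (Fin n) (Fin n) ℝ) {k : WithTop ℕ∞} :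
    ContDiff ℝ k (fun y : Fin n → ℝ => O *ᵥ y) :=
  (LinearMap.toContinuousLinearMap (Matrix.mulVecLin O)).contDiff

theorem grad_comp_mulVec {n : ℕ} (O : Matrix (Fin n) (Fin n) ℝ) {f : (Fin n → ℝ) → ℝ}
    {x : Fin n → ℝ} (hf : ContDiffAt ℝ 2 f (O *ᵥ x)) :
    grad (fun y => f (O *ᵥ y)) x = grad f (O *ᵥ x) ᵥ* O := by
  ext i
  rw [grad, fderiv_comp_grad (hf.differentiableAt (by simp))
    ((contDiff_mulVec O (k := 1)).differentiable (by simp) x), fderiv_mulVec,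
    Matrix.dotProduct_mulVec, dotProduct_single_one]

theorem hess_comp_mulVec {n : ℕ} (O : Matrix (Fin n) (Fin n) ℝ) {f : (Fin n → ℝ) → ℝ}
    {x : Fin n → ℝ} (hf : ContDiffAt ℝ 2 f (O *ᵥ x)) :
    hess (fun y => f (O *ᵥ y)) x = Oᵀ * hess f (O *ᵥ x) * O := by
  ext i j
  rw [hess, Matrix.of_apply, fderiv_fderiv_comp hf (contDiff_mulVec O).contDiffAt]
  simp only [fderiv_mulVec, fderiv_fun_const, Pi.zero_apply, zero_apply, dotProduct_zero, add_zero]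
  rw [mul_assoc, Matrix.mul_apply', Matrix.mulVec_single_one, Matrix.mulVec_single_one]
  rfl

theorem dotProduct_mulVec_mulVec {n : ℕ} {O : Matrix (Fin n) (Fin n) ℝ} (hO : Oᵀ * O = 1)
    (x y : Fin n → ℝ) : (O *ᵥ x) ⬝ᵥ (O *ᵥ y) = x ⬝ᵥ y := by
  rw [Matrix.dotProduct_mulVec, ← Matrix.mulVec_transpose, Matrix.mulVec_mulVec, hO,
    Matrix.one_mulVec]

/-- The gradient becomes OᵀG and the Hessian OᵀAO, and the operator is built only from inner
products, quadratic forms and traces that O preserves. -/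
theorem SolvesAt.comp_mulVec {n : ℕ} {O : Matrix (Fin n) (Fin n) ℝ} (hO : Oᵀ * O = 1)
    {f : (Fin n → ℝ) → ℝ} {x : Fin n → ℝ} (hf : ContDiffAt ℝ 2 f (O *ᵥ x))
    (h : SolvesAt f (O *ᵥ x)) : SolvesAt (fun y => f (O *ᵥ y)) x := by
  have hO' : O * Oᵀ = 1 := mul_eq_one_comm.1 hO
  rw [SolvesAt] at h ⊢
  rw [grad_comp_mulVec O hf, hess_comp_mulVec O hf]
  set G := grad f (O *ᵥ x)
  set A := hess f (O *ᵥ x)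
  have h1 : (G ᵥ* O) ⬝ᵥ x = G ⬝ᵥ O *ᵥ x := (Matrix.dotProduct_mulVec _ _ _).symm
  have h2 : (G ᵥ* O) ⬝ᵥ (G ᵥ* O) = G ⬝ᵥ G := by
    rw [← Matrix.dotProduct_mulVec, ← Matrix.mulVec_transpose, Matrix.mulVec_mulVec, hO',
      Matrix.one_mulVec]
  have h3 : conormSq x (G ᵥ* O) = conormSq (O *ᵥ x) G := by rw [conormSq, conormSq, h1, h2]
  have h4 : O *ᵥ raise x (G ᵥ* O) = raise (O *ᵥ x) G := by
    rw [raise, raise, h1, Matrix.mulVec_add, Matrix.mulVec_smul, ← Matrix.mulVec_transpose,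
      Matrix.mulVec_mulVec, hO', Matrix.one_mulVec]
  have h5 : ∀ v : Fin n → ℝ, v ⬝ᵥ (Oᵀ * A * O) *ᵥ v = (O *ᵥ v) ⬝ᵥ A *ᵥ (O *ᵥ v) := by
    intro v
    rw [← Matrix.mulVec_mulVec, ← Matrix.mulVec_mulVec, Matrix.dotProduct_mulVec,
      Matrix.vecMul_transpose]
  have h6 : (Oᵀ * A * O).trace = A.trace := by
    rw [mul_assoc, Matrix.trace_mul_comm, mul_assoc, hO', mul_one]
  rw [translatorOp, h3, h5, h5, h6, h4, h1]
  exact h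

/-! ### The comparison principle -/

/-- A positive second derivative would make t a local minimum as well, so g would be locally
constant and its second derivative 0. -/
theorem deriv_deriv_nonpos_of_isLocalMax {g : ℝ → ℝ} {t : ℝ} (hg : ContinuousAt g t)
    (h : IsLocalMax g t) : deriv (deriv g) t ≤ 0 := by
  by_contra hc
  push Not at hc
  have h1 : deriv g t = 0 := h.deriv_eq_zero
  have h2 := isLocalMin_of_deriv_deriv_pos hc h1 hg
  have h3 : g =ᶠ[nhds t] fun _ => g t := by
    filter_upwards [h, h2] with s hs hs2 using le_antisymm hs hs2
  have h4 : deriv g =ᶠ[nhds t] fun _ => 0 := by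
    have := h3.deriv; simpa using this
  rw [h4.deriv_eq] at hc
  simp at hc

theorem hess_nonpos_of_isLocalMax {n : ℕ} {f : (Fin n → ℝ) → ℝ} {x : Fin n → ℝ}
    (hf : ContDiffAt ℝ 2 f x) (h : IsLocalMax f x) :
    grad f x = 0 ∧ ∀ v, v ⬝ᵥ hess f x *ᵥ v ≤ 0 := by
  constructor
  · ext i; rw [grad, h.fderiv_eq_zero]; rfl
  · intro v
    set γ : ℝ → Fin n → ℝ := fun t => x + t • v with hγ
    have h0 : γ 0 = x := by simp [hγ]
    have hγc : ContDiff ℝ 2 γ := by fun_prop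
    have hγd : ∀ t, fderiv ℝ γ t 1 = v := by
      intro t
      have h : HasDerivAt γ ((1 : ℝ) • v) t := ((hasDerivAt_id t).smul_const v).const_add x
      rw [fderiv_apply_one_eq_deriv, h.deriv, one_smul]
    have hcomp := fderiv_fderiv_comp (ψ := γ) (x := 0) (by rwa [h0]) hγc.contDiffAt 1 1
    simp only [hγd, h0, fderiv_fun_const, Pi.zero_apply, zero_apply, dotProduct_zero, add_zero,
      fderiv_apply_one_eq_deriv] at hcomp
    rw [← hcomp]
    have hloc : IsLocalMax (fun t => f (γ t)) 0 := by
      have : ContinuousAt γ 0 := hγc.continuous.continuousAt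
      exact (h0.symm ▸ h : IsLocalMax f (γ 0)).comp_continuous this
    refine deriv_deriv_nonpos_of_isLocalMax ?_ hloc
    exact ContinuousAt.comp (g := f) (by rw [h0]; exact hf.continuousAt) hγc.continuous.continuousAt

/-- Polynomial in all its arguments; what the comparison needs is the resulting Lipschitz bound on
compact sets. -/
theorem contDiff_translatorOp {n : ℕ} :
    ContDiff ℝ 1 (fun p : (Fin n → ℝ) × (Fin n → ℝ) × (Fin n → Fin n → ℝ) =>
      translatorOp p.1 p.2.1 (Matrix.of p.2.2)) := by
  simp only [translatorOp, conormSq, raise, Matrix.trace, Matrix.diag_apply, Matrix.of_apply,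
    dotProduct, Matrix.mulVec, Pi.add_apply, Pi.smul_apply, smul_eq_mul]
  fun_prop

/-- The principal part of the translator operator. -/
def principalPart {n : ℕ} (x G : Fin n → ℝ) (S : Matrix (Fin n) (Fin n) ℝ) : ℝ :=
  (1 - conormSq x G) * (S.trace + x ⬝ᵥ S *ᵥ x) + raise x G ⬝ᵥ S *ᵥ raise x G

theorem translatorOp_sub {n : ℕ} (x G : Fin n → ℝ) (A B : Matrix (Fin n) (Fin n) ℝ) :
    translatorOp x G A - translatorOp x G B = principalPart x G (A - B) := by
  simp only [translatorOp, principalPart, Matrix.sub_mulVec, dotProduct_sub, Matrix.trace_sub]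
  ring

theorem principalPart_nonpos {n : ℕ} {x G : Fin n → ℝ} (hN : conormSq x G ≤ 1)
    {S : Matrix (Fin n) (Fin n) ℝ} (hS : ∀ v, v ⬝ᵥ S *ᵥ v ≤ 0) : principalPart x G S ≤ 0 := by
  have h1 : S.trace ≤ 0 := Finset.sum_nonpos fun i _ => by
    have := hS (Pi.single i 1)
    simpa using this
  have h2 := hS x
  have h3 := hS (raise x G)
  have h4 : (1 - conormSq x G) * (S.trace + x ⬝ᵥ S *ᵥ x) ≤ 0 :=
    mul_nonpos_of_nonneg_of_nonpos (by linarith) (by linarith)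
  rw [principalPart]; linarith

theorem principalPart_add_smul {n : ℕ} (x G : Fin n → ℝ) (S T : Matrix (Fin n) (Fin n) ℝ) (a : ℝ) :
    principalPart x G (S + a • T) = principalPart x G S + a * principalPart x G T := by
  simp only [principalPart, Matrix.add_mulVec, dotProduct_add, Matrix.trace_add, Matrix.smul_mulVec,
    dotProduct_smul, Matrix.trace_smul, smul_eq_mul]
  ring

/-- Ellipticity in one coordinate direction, the only one the barrier uses. -/
theorem le_principalPart_single {n : ℕ} (x G : Fin n → ℝ) (i : Fin n) (hN : conormSq x G ≤ 1) :
    1 - conormSq x G ≤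
      principalPart x G (Matrix.vecMulVec (Pi.single i 1) (Pi.single i 1)) := by
  have h : ∀ v : Fin n → ℝ, v ⬝ᵥ Matrix.vecMulVec (Pi.single i 1) (Pi.single i 1) *ᵥ v
      = v i ^ 2 := by
    intro v
    rw [Matrix.vecMulVec_mulVec, dotProduct_smul, single_one_dotProduct, dotProduct_single_one,
      MulOpposite.smul_eq_mul_unop, MulOpposite.unop_op, pow_two]
  rw [principalPart, h, h, Matrix.trace_vecMulVec, single_one_dotProduct, Pi.single_eq_same]
  have := mul_nonneg (sub_nonneg.2 hN) (sq_nonneg (x i))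
  nlinarith [sq_nonneg (raise x G i)]

/-- Barrier for the maximum principle: its Hessian outweighs its gradient by a factor α. -/
theorem grad_hess_exp {n : ℕ} (α : ℝ) (i : Fin n) (x : Fin n → ℝ) :
    grad (fun y => Real.exp (α * y i)) x = (α * Real.exp (α * x i)) • Pi.single i 1 ∧
    hess (fun y => Real.exp (α * y i)) x = (α ^ 2 * Real.exp (α * x i)) •
      Matrix.vecMulVec (Pi.single i 1) (Pi.single i 1) := by
  have h : ∀ (x v : Fin n → ℝ), fderiv ℝ (fun y : Fin n → ℝ => Real.exp (α * y i)) x v =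
      α * Real.exp (α * x i) * v i := by
    intro x v
    have h1 : HasFDerivAt (fun y : Fin n → ℝ => y i)
      (ContinuousLinearMap.proj (R := ℝ) (φ := fun _ : Fin n => ℝ) i) x :=
      (ContinuousLinearMap.proj (R := ℝ) (φ := fun _ : Fin n => ℝ) i).hasFDerivAt
    rw [((h1.const_mul α).exp).fderiv]
    simp; ring
  constructor
  · ext j
    rw [grad, h]
    simp [Pi.single_apply, eq_comm]
  · ext j k
    rw [hess, Matrix.of_apply]
    simp only [h]
    have hd : DifferentiableAt ℝ (fun y : Fin n → ℝ => Real.exp (α * y i)) x := by fun_prop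
    have : (fun y : Fin n → ℝ => α * Real.exp (α * y i) * (Pi.single k 1 : Fin n → ℝ) i) =
        fun y => (α * (Pi.single k 1 : Fin n → ℝ) i) * Real.exp (α * y i) := by
      funext y; ring
    rw [this, fderiv_const_mul hd, smul_apply, h]
    simp only [Matrix.smul_apply, Matrix.vecMulVec_apply, smul_eq_mul, Pi.single_apply,
      eq_comm (a := i)]
    ring

theorem grad_add_mul {n : ℕ} {f g : (Fin n → ℝ) → ℝ} {x : Fin n → ℝ} (a : ℝ)
    (hf : DifferentiableAt ℝ f x) (hg : DifferentiableAt ℝ g x) :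
    grad (fun y => f y + a * g y) x = grad f x + a • grad g x := by
  ext i
  simp only [grad, Pi.add_apply, Pi.smul_apply]
  rw [fderiv_fun_add hf (hg.const_mul a), fderiv_const_mul hg]
  rfl

theorem hess_add_mul {n : ℕ} {f g : (Fin n → ℝ) → ℝ} {x : Fin n → ℝ} (a : ℝ)
    (hf : ContDiffAt ℝ 2 f x) (hg : ContDiffAt ℝ 2 g x) :
    hess (fun y => f y + a * g y) x = hess f x + a • hess g x := by
  ext i j
  simp only [hess, Matrix.of_apply, Matrix.add_apply, Matrix.smul_apply]
  have h : (fun y => fderiv ℝ (fun y => f y + a * g y) y (Pi.single j 1)) =ᶠ[nhds x]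
      fun y => fderiv ℝ f y (Pi.single j 1) + a * fderiv ℝ g y (Pi.single j 1) := by
    filter_upwards [eventually_contDiffAt_two hf, eventually_contDiffAt_two hg] with y h1 h2
    have h1 := h1.differentiableAt (by simp)
    have h2 := h2.differentiableAt (by simp)
    rw [fderiv_fun_add h1 (h2.const_mul a), fderiv_const_mul h2]
    rfl
  have h1 := (contDiffAt_fderiv_apply hf (Pi.single j 1)).differentiableAt (by simp)
  have h2 := (contDiffAt_fderiv_apply hg (Pi.single j 1)).differentiableAt (by simp)
  rw [h.fderiv_eq, fderiv_fun_add h1 (h2.const_mul a), fderiv_const_mul h2]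
  rfl

/-- Comparison principle for space-like solutions. -/
theorem comparison {n : ℕ} (i₀ : Fin n) {K Ω : Set (Fin n → ℝ)} (hK : IsCompact K)
    (hΩ : IsOpen Ω) (hΩK : Ω ⊆ K) {f g : (Fin n → ℝ) → ℝ}
    (hf : ∀ x ∈ Ω, ContDiffAt ℝ 2 f x) (hg : ∀ x ∈ Ω, ContDiffAt ℝ 2 g x)
    (hfs : ∀ x ∈ Ω, SolvesAt f x) (hgs : ∀ x ∈ Ω, SolvesAt g x)
    (hc : ContinuousOn (fun x => f x - g x) K) (hb : ∀ x ∈ K, x ∉ Ω → f x - g x ≤ 0) :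
    ∀ x ∈ K, f x ≤ g x := by
  intro x₁ hx₁
  by_contra hcon
  push Not at hcon
  set φ := fun x => f x - g x with hφ
  set m := φ x₁ with hm
  have hm0 : 0 < m := sub_pos.2 hcon
  -- A compact subset of Ω, on which the space-like bound and all derivatives are uniform although
  -- both may degenerate at the boundary of Ω.
  set K' := {x ∈ K | m / 2 ≤ φ x} with hK'
  have hK'c : IsCompact K' :=
    hK.of_isClosed_subset (hc.preimage_isClosed_of_isClosed hK.isClosed isClosed_Ici)
      fun x hx => hx.1
  have hK'Ω : K' ⊆ Ω := by
    intro x hx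
    by_contra hxΩ
    have := hb x hx.1 hxΩ
    linarith [hx.2]
  have hx₁' : x₁ ∈ K' := ⟨hx₁, by linarith⟩
  have cgf : ContinuousOn (grad f) K' := fun x hx =>
    (contDiffAt_grad (hf x (hK'Ω hx))).continuousAt.continuousWithinAt
  have cgg : ContinuousOn (grad g) K' := fun x hx =>
    (contDiffAt_grad (hg x (hK'Ω hx))).continuousAt.continuousWithinAt
  set A : (Fin n → ℝ) → Fin n → Fin n → ℝ := fun x i j => hess g x i j with hA
  have hAof : ∀ x, Matrix.of (A x) = hess g x := fun _ => rfl
  have chg : ContinuousOn A K' := fun x hx =>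
    (continuousAt_hess (hg x (hK'Ω hx))).continuousWithinAt
  obtain ⟨δ, hδ, hδK⟩ : ∃ δ > 0, ∀ x ∈ K', conormSq x (grad f x) ≤ 1 - δ := by
    have : ContinuousOn (fun x => conormSq x (grad f x)) K' := by
      simp only [conormSq, dotProduct]
      have := fun i => (continuous_apply i).comp_continuousOn cgf
      simp only [Function.comp_def] at this
      fun_prop
    obtain ⟨x₀, hx₀, hmax⟩ := hK'c.exists_isMaxOn ⟨x₁, hx₁'⟩ this
    refine ⟨1 - conormSq x₀ (grad f x₀), sub_pos.2 (hfs x₀ (hK'Ω hx₀)).1, fun x hx => ?_⟩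
    have := hmax hx
    simp only [Set.mem_ofPred_eq] at this
    linarith
  obtain ⟨R, hR⟩ : ∃ R, ∀ x ∈ K', ‖x‖ ≤ R ∧ ‖grad f x‖ ≤ R ∧ ‖grad g x‖ ≤ R ∧
      ‖A x‖ ≤ R := by
    obtain ⟨R, hR⟩ := hK'c.exists_bound_of_continuousOn
      (continuousOn_id.prodMk (cgf.prodMk (cgg.prodMk chg)))
    refine ⟨R, fun x hx => ?_⟩
    have := hR x hx
    simpa [Prod.norm_def] using this
  obtain ⟨C, hC⟩ := (contDiff_translatorOp (n := n)).locallyLipschitz.locallyLipschitzOn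
    |>.exists_lipschitzOnWith_of_compact (isCompact_closedBall 0 R)
  have hLip : ∀ x ∈ K', |translatorOp x (grad f x) (hess g x) -
      translatorOp x (grad g x) (hess g x)| ≤ C * ‖grad f x - grad g x‖ := by
    intro x hx
    obtain ⟨h1, h2, h3, h4⟩ := hR x hx
    have := hC.dist_le_mul (x, grad f x, A x)
      (by simp [Prod.norm_def, h1, h2, h4]) (x, grad g x, A x)
      (by simp [Prod.norm_def, h1, h3, h4])
    rw [Prod.dist_eq, Prod.dist_eq, dist_self, dist_self, max_eq_left dist_nonneg,
      max_eq_right dist_nonneg, dist_eq_norm, dist_eq_norm, Real.norm_eq_abs] at this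
    simpa only [hAof] using this
  -- Chosen so that αδ > C: the Hessian of the barrier then beats the Lipschitz error caused by its
  -- gradient.
  set α : ℝ := (C + 1) / δ with hα
  have hα0 : 0 < α := by positivity
  set h : (Fin n → ℝ) → ℝ := fun y => Real.exp (α * y i₀) with hh
  have hhc : ContDiff ℝ 2 h := by simp only [hh]; fun_prop
  obtain ⟨B, hB⟩ := hK.exists_bound_of_continuousOn hhc.continuous.continuousOn
  have hB0 : 0 < B := lt_of_lt_of_le (norm_pos_iff.2 (Real.exp_pos _).ne') (hB x₁ hx₁)
  -- The perturbation ε h stays at most m/2 on K, which forces the maximum point of φ + ε h into K'.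
  set ε : ℝ := m / (2 * B) with hε
  have hε0 : 0 < ε := by positivity
  obtain ⟨x, hxK, hmax⟩ := hK.exists_isMaxOn ⟨x₁, hx₁⟩
    (hc.add (continuousOn_const.mul hhc.continuous.continuousOn) :
      ContinuousOn (fun x => φ x + ε * h x) K)
  have hxK' : x ∈ K' := by
    refine ⟨hxK, ?_⟩
    have h1 : φ x₁ + ε * h x₁ ≤ φ x + ε * h x := hmax hx₁
    have h2 : h x ≤ B := (le_abs_self _).trans (hB x hxK)
    have h3 : 0 < ε * h x₁ := mul_pos hε0 (Real.exp_pos _)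
    have h4 : ε * h x ≤ m / 2 := by
      calc ε * h x ≤ ε * B := by gcongr
        _ = m / 2 := by rw [hε]; field_simp
    linarith
  have hxΩ := hK'Ω hxK'
  have dfx := hf x hxΩ
  have dgx := hg x hxΩ
  have hloc : IsLocalMax (fun x => φ x + ε * h x) x :=
    hmax.isLocalMax (Filter.mem_of_superset (hΩ.mem_nhds hxΩ) hΩK)
  have hφ1 : ContDiffAt ℝ 2 φ x := dfx.sub dgx
  have hφe : φ = fun y => f y + (-1) * g y := by funext y; simp only [hφ]; ring
  obtain ⟨hg1, hh1⟩ := hess_nonpos_of_isLocalMax (hφ1.add (contDiffAt_const.mul hhc.contDiffAt)) hloc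
  obtain ⟨he1, he2⟩ := grad_hess_exp α i₀ x
  rw [grad_add_mul ε (hφ1.differentiableAt (by simp)) (hhc.differentiable (by simp) x), hφe,
    grad_add_mul _ (dfx.differentiableAt (by simp)) (dgx.differentiableAt (by simp)), he1] at hg1
  rw [hess_add_mul ε hφ1 hhc.contDiffAt, hφe, hess_add_mul _ dfx dgx, he2] at hh1
  have hs := (hfs x hxΩ).2
  have hs2 := (hgs x hxΩ).2
  have hN := (hfs x hxΩ).1.le
  -- The principal part is frozen at the gradient of f, so replacing the Hessian of f by that of g
  -- is exact; only the change of gradient, of size εαh, costs a Lipschitz error.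
  have hnonpos := principalPart_nonpos hN hh1
  rw [smul_smul, principalPart_add_smul, neg_one_smul, ← sub_eq_add_neg, ← translatorOp_sub,
    hs] at hnonpos
  have hl := (le_abs_self _).trans (hLip x hxK')
  have hgn : ‖grad f x - grad g x‖ = ε * (α * h x) := by
    have h1 : grad f x - grad g x = -((ε * (α * h x)) • (Pi.single i₀ 1 : Fin n → ℝ)) := by
      rw [neg_one_smul, smul_smul, ← sub_eq_add_neg] at hg1
      exact eq_neg_of_add_eq_zero_left hg1
    have h0 : 0 < h x := Real.exp_pos _
    rw [h1, norm_neg, norm_smul, Pi.norm_single, norm_one, mul_one, Real.norm_eq_abs,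
      abs_of_pos (by positivity)]
  have hlow := (sub_le_sub_left (hδK x hxK') 1).trans (le_principalPart_single x (grad f x) i₀ hN)
  rw [sub_sub_cancel] at hlow
  rw [hs2, sub_zero, hgn] at hl
  have h0 : 0 < h x := Real.exp_pos _
  have h5 : ε * (α ^ 2 * h x) * δ ≤ C * (ε * (α * h x)) := by
    calc ε * (α ^ 2 * h x) * δ ≤ ε * (α ^ 2 * h x) * principalPart x (grad f x)
          (Matrix.vecMulVec (Pi.single i₀ 1) (Pi.single i₀ 1)) := by gcongr
      _ ≤ translatorOp x (grad f x) (hess g x) := by linarith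
      _ ≤ _ := hl
  have h6 : α * δ = C + 1 := by rw [hα]; field_simp
  have h7 : ε * (α ^ 2 * h x) * δ = (C + 1) * (ε * (α * h x)) := by rw [← h6]; ring
  have h8 : 0 < ε * (α * h x) := by positivity
  linarith

/-! ### Radial symmetry -/

theorem norm_fderiv_le_of_solvesAt {n : ℕ} {f : (Fin n → ℝ) → ℝ} {x : Fin n → ℝ}
    (h : SolvesAt f x) : ‖fderiv ℝ f x‖ ≤ n := by
  have h1 : grad f x ⬝ᵥ grad f x ≤ 1 := by
    have := h.1
    rw [conormSq] at this
    nlinarith [sq_nonneg (grad f x ⬝ᵥ x)]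
  have h2 : ∀ i, |grad f x i| ≤ 1 := by
    intro i
    have : grad f x i * grad f x i ≤ grad f x ⬝ᵥ grad f x :=
      Finset.single_le_sum (f := fun i => grad f x i * grad f x i)
        (fun j _ => mul_self_nonneg _) (Finset.mem_univ i)
    exact abs_le_one_iff_mul_self_le_one.2 (this.trans h1)
  refine ContinuousLinearMap.opNorm_le_bound _ n.cast_nonneg fun v => ?_
  rw [fderiv_eq_grad, Real.norm_eq_abs]
  calc |grad f x ⬝ᵥ v| ≤ ∑ i, |grad f x i * v i| := Finset.abs_sum_le_sum_abs _ _
    _ ≤ ∑ _i : Fin n, ‖v‖ := Finset.sum_le_sum fun i _ => by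
        rw [abs_mul]
        calc _ ≤ 1 * ‖v‖ := mul_le_mul (h2 i) (norm_le_pi_norm v i) (abs_nonneg _) zero_le_one
          _ = ‖v‖ := one_mul _
    _ = n * ‖v‖ := by simp

/-- The mean value inequality applies along a segment missing 0. If the segment from x to y meets 0,
detour through a point of another coordinate axis; each leg costs at most 2Cτ. -/
theorem abs_sub_le_near_puncture {n : ℕ} (hn : 2 ≤ n) {f : (Fin n → ℝ) → ℝ} {C τ : ℝ}
    (hC : 0 ≤ C)
    (hd : ∀ x, x ≠ 0 → ‖x‖ ≤ τ → DifferentiableAt ℝ f x ∧ ‖fderiv ℝ f x‖ ≤ C)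
    {x y : Fin n → ℝ} (hx : x ≠ 0) (hy : y ≠ 0) (hxτ : ‖x‖ ≤ τ) (hyτ : ‖y‖ ≤ τ) :
    |f x - f y| ≤ 4 * C * τ := by
  have key : ∀ x y : Fin n → ℝ, ‖x‖ ≤ τ → ‖y‖ ≤ τ → (0 : Fin n → ℝ) ∉ segment ℝ x y →
      |f x - f y| ≤ C * (2 * τ) := by
    intro x y hx hy h0
    have hs : ∀ z ∈ segment ℝ x y, z ≠ 0 ∧ ‖z‖ ≤ τ := by
      intro z hz
      refine ⟨fun h => h0 (h ▸ hz), ?_⟩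
      have := (convex_closedBall (0 : Fin n → ℝ) τ).segment_subset (by simpa using hx)
        (by simpa using hy) hz
      simpa using this
    have := (convex_segment y x).norm_image_sub_le_of_norm_fderiv_le (𝕜 := ℝ) (f := f) (C := C)
      (fun z hz => (hd z (hs z (segment_symm ℝ y x ▸ hz)).1 (hs z (segment_symm ℝ y x ▸ hz)).2).1)
      (fun z hz => (hd z (hs z (segment_symm ℝ y x ▸ hz)).1 (hs z (segment_symm ℝ y x ▸ hz)).2).2)
      (left_mem_segment ℝ y x) (right_mem_segment ℝ y x)
    rw [← Real.norm_eq_abs]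
    refine this.trans (mul_le_mul_of_nonneg_left ?_ hC)
    linarith [norm_sub_le x y]
  have hτ : 0 ≤ τ := (norm_nonneg x).trans hxτ
  by_cases h0 : (0 : Fin n → ℝ) ∈ segment ℝ x y
  · obtain ⟨i, hi⟩ : ∃ i, x i ≠ 0 := Function.ne_iff.1 hx
    obtain ⟨a, b, ha, hb, hab, h⟩ := h0
    have hyi : y i ≠ 0 := by
      intro hyi
      have h1 := congrFun h i
      simp only [Pi.add_apply, Pi.smul_apply, hyi, smul_eq_mul, mul_zero, add_zero,
        Pi.zero_apply] at h1
      have ha0 : a = 0 := (mul_eq_zero.1 h1).resolve_right hi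
      have hb1 : b = 1 := by linarith
      rw [ha0, hb1] at h
      exact hy (by simpa using h)
    have : Nontrivial (Fin n) := Fin.nontrivial_iff_two_le.2 hn
    obtain ⟨j, hj⟩ := exists_ne i
    -- The detour point has i-th coordinate 0 and v does not, so 0 could only be the endpoint, which
    -- is nonzero.
    have hw : ∀ v : Fin n → ℝ, v i ≠ 0 → (0 : Fin n → ℝ) ∉ segment ℝ v (Pi.single j (x i)) := by
      rintro v hv ⟨a, b, -, -, hab, h⟩
      have h1 := congrFun h i
      have h2 := congrFun h j
      simp only [Pi.add_apply, Pi.smul_apply, Pi.single_eq_of_ne hj.symm, smul_eq_mul, mul_zero,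
        add_zero, Pi.zero_apply, Pi.single_eq_same] at h1 h2
      have ha0 : a = 0 := (mul_eq_zero.1 h1).resolve_right hv
      have hb1 : b = 1 := by linarith
      rw [ha0, hb1] at h2
      exact hi (by simpa using h2)
    have hwn : ‖(Pi.single j (x i) : Fin n → ℝ)‖ ≤ τ := by
      rw [Pi.norm_single]; exact (norm_le_pi_norm x i).trans hxτ
    have h1 := key x _ hxτ hwn (hw x hi)
    have h2 := key y _ hyτ hwn (hw y hyi)
    rw [abs_le] at h1 h2 ⊢
    constructor <;> linarith
  · have := key x y hxτ hyτ h0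
    have h2 := mul_nonneg hC hτ
    linarith

theorem isOpen_dotProduct_lt {n : ℕ} (R : ℝ) : IsOpen {x : Fin n → ℝ | x ⬝ᵥ x < R} :=
  isOpen_lt (by unfold dotProduct; fun_prop) continuous_const

theorem dotProduct_self_pos {n : ℕ} {x : Fin n → ℝ} : 0 < x ⬝ᵥ x ↔ x ≠ 0 := by
  rw [← not_iff_not, not_not, not_lt]
  constructor
  · intro h
    have h2 : 0 ≤ x ⬝ᵥ x := Finset.sum_nonneg fun _ _ => mul_self_nonneg _
    exact dotProduct_self_eq_zero.1 (le_antisymm h h2)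
  · rintro rfl; simp

theorem isCompact_dotProduct_le {n : ℕ} (R : ℝ) : IsCompact {x : Fin n → ℝ | x ⬝ᵥ x ≤ R} := by
  refine Metric.isCompact_of_isClosed_isBounded
    (isClosed_le (by unfold dotProduct; fun_prop) continuous_const) ?_
  refine (Metric.isBounded_closedBall (x := (0 : Fin n → ℝ)) (r := 1 + |R|)).subset fun x hx => ?_
  rw [mem_closedBall_zero_iff, pi_norm_le_iff_of_nonneg (by positivity)]
  intro i
  have h1 : x i * x i ≤ x ⬝ᵥ x := Finset.single_le_sum (f := fun i => x i * x i)
    (fun j _ => mul_self_nonneg _) (Finset.mem_univ i)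
  have h2 : x ⬝ᵥ x ≤ R := hx
  have h3 := le_abs_self R
  rw [Real.norm_eq_abs]
  refine abs_le_of_sq_le_sq ?_ (by positivity)
  nlinarith [abs_nonneg R]

/-- A solution on a punctured ball with constant boundary values is invariant under orthogonal
maps. -/
theorem le_comp_mulVec {n : ℕ} (hn : 2 ≤ n) {f : (Fin n → ℝ) → ℝ} {R k : ℝ} (hR : 0 < R)
    (hf : ∀ x, 0 < x ⬝ᵥ x → x ⬝ᵥ x < R → ContDiffAt ℝ 2 f x)
    (hs : ∀ x, 0 < x ⬝ᵥ x → x ⬝ᵥ x < R → SolvesAt f x)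
    (hc : ContinuousOn f ({x | x ⬝ᵥ x ≤ R} \ {0})) (hk : ∀ x, x ⬝ᵥ x = R → f x = k)
    {O : Matrix (Fin n) (Fin n) ℝ} (hO : Oᵀ * O = 1) {x : Fin n → ℝ} (hx : x ⬝ᵥ x ≤ R) :
    f x = f (O *ᵥ x) := by
  set K := {x : Fin n → ℝ | x ⬝ᵥ x ≤ R} with hK
  set Ω := {x : Fin n → ℝ | x ⬝ᵥ x < R} ∩ {0}ᶜ with hΩ
  have hOd : ∀ x : Fin n → ℝ, (O *ᵥ x) ⬝ᵥ (O *ᵥ x) = x ⬝ᵥ x := fun x =>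
    dotProduct_mulVec_mulVec hO x x
  have hOc : Continuous fun x : Fin n → ℝ => O *ᵥ x := (contDiff_mulVec O (k := 0)).continuous
  have hO0 : ∀ x : Fin n → ℝ, x ≠ 0 → O *ᵥ x ≠ 0 := fun x hx => by
    rw [← dotProduct_self_pos, hOd, dotProduct_self_pos]; exact hx
  have hΩo : IsOpen Ω := (isOpen_dotProduct_lt R).inter isOpen_compl_singleton
  have hΩK : Ω ⊆ K := fun x hx =>
    (show x ⬝ᵥ x < R from hx.1).le
  have h1 : ∀ x ∈ Ω, ContDiffAt ℝ 2 f x := fun x hx => hf x (dotProduct_self_pos.2 hx.2) hx.1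
  have h2 : ∀ x ∈ Ω, SolvesAt f x := fun x hx => hs x (dotProduct_self_pos.2 hx.2) hx.1
  have hOΩ : ∀ x ∈ Ω, O *ᵥ x ∈ Ω := fun x hx =>
    ⟨by rw [Set.mem_ofPred_eq, hOd]; exact hx.1, hO0 x hx.2⟩
  have h1' : ∀ x ∈ Ω, ContDiffAt ℝ 2 (fun y => f (O *ᵥ y)) x := fun x hx =>
    (h1 _ (hOΩ x hx)).comp x (contDiff_mulVec O).contDiffAt
  have h2' : ∀ x ∈ Ω, SolvesAt (fun y => f (O *ᵥ y)) x := fun x hx =>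
    (h2 _ (hOΩ x hx)).comp_mulVec hO (h1 _ (hOΩ x hx))
  -- At 0 the arbitrary value of f cancels, as O fixes 0; nearby, x and Ox lie in the same small
  -- punctured ball, where f oscillates little.
  have hcont : ContinuousOn (fun x => f x - f (O *ᵥ x)) K := by
    intro x hx
    by_cases hx0 : x = 0
    · subst hx0
      rw [Metric.continuousWithinAt_iff]
      intro ε hε
      obtain ⟨τ, hτ, hball⟩ := Metric.isOpen_iff.1 (isOpen_dotProduct_lt (n := n) R) 0
        (by simpa using hR)
      have hn0 : (0 : ℝ) < n := by exact_mod_cast (by omega : 0 < n)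
      set ρ := min (τ / 2) (ε / (8 * n)) with hρ
      have hρ0 : 0 < ρ := by positivity
      have hin : ∀ z : Fin n → ℝ, ‖z‖ ≤ ρ → z ⬝ᵥ z < R := fun z hz => by
        refine hball (mem_ball_zero_iff.2 (hz.trans_lt ?_))
        exact (min_le_left _ _).trans_lt (by linarith)
      obtain ⟨τ', hτ', hball'⟩ := Metric.continuousAt_iff.1 (hOc.continuousAt (x := 0)) ρ hρ0
      refine ⟨min ρ τ', by positivity, fun {x} _ hxd => ?_⟩
      rw [Matrix.mulVec_zero, sub_self, dist_zero_right, Real.norm_eq_abs]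
      by_cases hx0 : x = 0
      · subst hx0; simpa using hε
      have hb1 : ‖x‖ ≤ ρ := by
        rw [dist_zero_right] at hxd
        exact (hxd.trans_le (min_le_left _ _)).le
      have hb2 : ‖O *ᵥ x‖ ≤ ρ := by
        have := hball' (hxd.trans_le (min_le_right _ _))
        rw [Matrix.mulVec_zero, dist_zero_right] at this
        exact this.le
      have := abs_sub_le_near_puncture hn (f := f) (C := n) (τ := ρ) hn0.le
        (fun z hz hzρ => ⟨(hf z (dotProduct_self_pos.2 hz) (hin z hzρ)).differentiableAt (by simp),
          norm_fderiv_le_of_solvesAt (hs z (dotProduct_self_pos.2 hz) (hin z hzρ))⟩)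
        hx0 (hO0 x hx0) hb1 hb2
      refine this.trans_lt ?_
      have h3 : ρ ≤ ε / (8 * n) := min_le_right _ _
      calc 4 * (n : ℝ) * ρ ≤ 4 * n * (ε / (8 * n)) := by gcongr
        _ = ε / 2 := by field_simp; norm_num
        _ < ε := by linarith
    · have hcO : ContinuousOn (fun x => f (O *ᵥ x)) (K \ {0}) :=
        hc.comp hOc.continuousOn fun x hx =>
          ⟨by rw [Set.mem_ofPred_eq, hOd]; exact hx.1, hO0 x hx.2⟩
      refine ((hc.sub hcO) x ⟨hx, hx0⟩).mono_of_mem_nhdsWithin ?_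
      exact Filter.inter_mem self_mem_nhdsWithin
        (mem_nhdsWithin_of_mem_nhds (isOpen_compl_singleton.mem_nhds hx0))
  have hbd : ∀ x ∈ K, x ∉ Ω → f x = f (O *ᵥ x) := by
    intro x hx hxΩ
    by_cases hx0 : x = 0
    · rw [hx0, Matrix.mulVec_zero]
    · have : x ⬝ᵥ x = R := by
        refine le_antisymm hx (not_lt.1 fun h => hxΩ ⟨h, hx0⟩)
      rw [hk x this, hk _ ((hOd x).trans this)]
  have i₀ : Fin n := ⟨0, by omega⟩
  have hKc : IsCompact K := isCompact_dotProduct_le R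
  refine le_antisymm ?_ ?_
  · exact comparison i₀ hKc hΩo hΩK h1 h1' h2 h2' hcont
      (fun x hx hxΩ => (sub_eq_zero.2 (hbd x hx hxΩ)).le) x hx
  · refine comparison i₀ hKc hΩo hΩK h1' h1 h2' h2 ?_
      (fun x hx hxΩ => (sub_eq_zero.2 (hbd x hx hxΩ).symm).le) x hx
    exact hcont.neg.congr fun x _ => (neg_sub _ _).symm

/-- Householder reflection in the bisecting hyperplane of x and y. -/
theorem exists_orthogonal_mulVec_eq {n : ℕ} {x y : Fin n → ℝ} (h : x ⬝ᵥ x = y ⬝ᵥ y) :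
    ∃ O : Matrix (Fin n) (Fin n) ℝ, Oᵀ * O = 1 ∧ O *ᵥ x = y := by
  by_cases hxy : x = y
  · exact ⟨1, by simp, by simp [hxy]⟩
  set m := x - y with hm
  have hmm : 0 < m ⬝ᵥ m := dotProduct_self_pos.2 (sub_ne_zero.2 hxy)
  have hmx : m ⬝ᵥ x = (m ⬝ᵥ m) / 2 := by
    simp only [hm, sub_dotProduct, dotProduct_sub, dotProduct_comm y x]; linarith
  refine ⟨1 - (2 / (m ⬝ᵥ m)) • Matrix.vecMulVec m m, ?_, ?_⟩
  · have h2 : Matrix.vecMulVec m m * Matrix.vecMulVec m m = (m ⬝ᵥ m) • Matrix.vecMulVec m m :=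
      vecMulVec_mul_vecMulVec_eq_smul m m m m
    have h3 : (Matrix.vecMulVec m m)ᵀ = Matrix.vecMulVec m m := Matrix.transpose_vecMulVec m m
    rw [Matrix.transpose_sub, Matrix.transpose_smul, Matrix.transpose_one, h3, sub_mul, mul_sub,
      mul_sub, smul_mul_smul_comm, h2]
    ext i j
    simp only [one_mul, mul_one, Matrix.sub_apply, Matrix.smul_apply, smul_eq_mul]
    field_simp
    ring
  · rw [Matrix.sub_mulVec, Matrix.one_mulVec, Matrix.smul_mulVec, Matrix.vecMulVec_mulVec, hmx]
    ext i
    have hmi : m i = x i - y i := rfl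
    simp only [Pi.sub_apply, Pi.smul_apply, hmi, MulOpposite.smul_eq_mul_unop, smul_eq_mul,
      MulOpposite.unop_op]
    field_simp
    ring

theorem radial_of_solves {n : ℕ} (hn : 2 ≤ n) {f : (Fin n → ℝ) → ℝ} {R k : ℝ} (hR : 0 < R)
    (hf : ∀ x, 0 < x ⬝ᵥ x → x ⬝ᵥ x < R → ContDiffAt ℝ 2 f x)
    (hs : ∀ x, 0 < x ⬝ᵥ x → x ⬝ᵥ x < R → SolvesAt f x)
    (hc : ContinuousOn f ({x | x ⬝ᵥ x ≤ R} \ {0})) (hk : ∀ x, x ⬝ᵥ x = R → f x = k)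
    {x y : Fin n → ℝ} (hx : x ⬝ᵥ x ≤ R) (hxy : x ⬝ᵥ x = y ⬝ᵥ y) : f x = f y := by
  obtain ⟨O, hO, rfl⟩ := exists_orthogonal_mulVec_eq hxy
  exact le_comp_mulVec hn hR hf hs hc hk hO hx

/-! ### The profile equation -/

theorem deriv_along_curve {n : ℕ} {f : (Fin n → ℝ) → ℝ} {γ γ' : ℝ → Fin n → ℝ}
    {γ'' : Fin n → ℝ} {t : ℝ} (hf : ContDiffAt ℝ 2 f (γ t)) (hγ : ContDiff ℝ 2 γ)
    (h1 : ∀ s, HasDerivAt γ (γ' s) s) (h2 : HasDerivAt γ' γ'' t) :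
    deriv (fun s => f (γ s)) t = grad f (γ t) ⬝ᵥ γ' t ∧
    deriv (deriv fun s => f (γ s)) t =
      γ' t ⬝ᵥ hess f (γ t) *ᵥ γ' t + grad f (γ t) ⬝ᵥ γ'' := by
  have h1' : deriv γ = γ' := funext fun s => (h1 s).deriv
  have hg1 := fderiv_comp_grad (hf.differentiableAt (by simp))
    (hγ.contDiffAt.differentiableAt (by simp)) (1 : ℝ)
  have hg2 := fderiv_fderiv_comp hf hγ.contDiffAt (1 : ℝ) (1 : ℝ)
  simp only [fderiv_apply_one_eq_deriv, h1', h2.deriv] at hg1 hg2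
  exact ⟨hg1, hg2⟩

/-- Since f is constant along the circle of radius τ in the (i, k)-plane, its first two derivatives
along that circle vanish. -/
theorem grad_hess_of_radial {n : ℕ} {f : (Fin n → ℝ) → ℝ} {R τ : ℝ} {i k : Fin n} (hik : k ≠ i)
    (hτ : 0 < τ) (hτR : τ ^ 2 < R)
    (hf : ContDiffAt ℝ 2 f (τ • Pi.single i 1))
    (hr : ∀ x y, x ⬝ᵥ x < R → x ⬝ᵥ x = y ⬝ᵥ y → f x = f y) :
    grad f (τ • Pi.single i 1) k = 0 ∧
      hess f (τ • Pi.single i 1) k k = grad f (τ • Pi.single i 1) i / τ := by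
  set a : Fin n → ℝ := Pi.single i 1 with ha
  set b : Fin n → ℝ := Pi.single k 1 with hb
  set γ : ℝ → Fin n → ℝ := fun t => (τ * Real.cos t) • a + (τ * Real.sin t) • b with hγ
  have haa : a ⬝ᵥ a = 1 := by simp [ha]
  have hbb : b ⬝ᵥ b = 1 := by simp [hb]
  have hab : a ⬝ᵥ b = 0 := by simp [ha, hb, hik.symm]
  have hba : b ⬝ᵥ a = 0 := by rw [dotProduct_comm, hab]
  have h0 : γ 0 = τ • a := by simp [hγ]
  have h1 : ∀ s, HasDerivAt γ ((τ * -Real.sin s) • a + (τ * Real.cos s) • b) s := fun s =>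
    (((Real.hasDerivAt_cos s).const_mul τ).smul_const a).add
      (((Real.hasDerivAt_sin s).const_mul τ).smul_const b)
  have h2 : HasDerivAt (fun s => (τ * -Real.sin s) • a + (τ * Real.cos s) • b)
      ((τ * -Real.cos 0) • a + (τ * -Real.sin 0) • b) 0 :=
    (((Real.hasDerivAt_sin 0).neg.const_mul τ).smul_const a).add
      (((Real.hasDerivAt_cos 0).const_mul τ).smul_const b)
  have hn : ∀ t, γ t ⬝ᵥ γ t = τ ^ 2 := by
    intro t
    simp only [hγ, add_dotProduct, dotProduct_add, smul_dotProduct, dotProduct_smul, haa, hbb, hab,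
      hba, smul_eq_mul]
    linear_combination τ ^ 2 * Real.sin_sq_add_cos_sq t
  have hconst : (fun s => f (γ s)) = fun _ => f (γ 0) := by
    funext s
    exact hr _ _ (by rw [hn]; exact hτR) (by rw [hn, hn])
  obtain ⟨e1, e2⟩ := deriv_along_curve (t := 0) (by rwa [h0]) (by simp only [hγ]; fun_prop) h1 h2
  rw [hconst] at e1 e2
  simp only [h0, deriv_const', Real.sin_zero, Real.cos_zero, neg_zero, mul_zero, mul_one, zero_smul,
    zero_add, add_zero, dotProduct_smul, hb, dotProduct_single_one, smul_eq_mul,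
    Matrix.mulVec_smul, Matrix.mulVec_single_one, smul_dotProduct, single_one_dotProduct, ha,
    Matrix.col_apply] at e1 e2
  have hτ0 := hτ.ne'
  constructor
  · simpa [hτ0] using e1.symm
  · rw [eq_div_iff hτ0]
    have : τ * (hess f (τ • Pi.single i 1) k k * τ - grad f (τ • Pi.single i 1) i) = 0 := by
      linear_combination -e2
    exact sub_eq_zero.1 ((mul_eq_zero.1 this).resolve_left hτ0)

theorem contDiff_sinh_smul {n : ℕ} (a : Fin n → ℝ) :
    ContDiff ℝ 2 (fun s : ℝ => Real.sinh s • a) := Real.contDiff_sinh.smul contDiff_const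

/-- On the geodesic, w = cosh(s) Gᵢ and |G|² = w²; the n - 1 transverse second derivatives equal Gᵢ
/ sinh(s) and produce the coth term. -/
theorem profile_ode {n : ℕ} {f : (Fin n → ℝ) → ℝ} {R s : ℝ} (i : Fin n)
    (hs : 0 < s) (hsR : Real.sinh s ^ 2 < R)
    (hf : ContDiffAt ℝ 2 f (Real.sinh s • Pi.single i 1))
    (hsol : SolvesAt f (Real.sinh s • Pi.single i 1))
    (hr : ∀ x y, x ⬝ᵥ x < R → x ⬝ᵥ x = y ⬝ᵥ y → f x = f y) :
    |deriv (fun t => f (Real.sinh t • Pi.single i 1)) s| < 1 ∧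
    HasDerivAt (deriv fun t => f (Real.sinh t • Pi.single i 1))
      ((1 - deriv (fun t => f (Real.sinh t • Pi.single i 1)) s ^ 2) *
        (1 - ((n : ℝ) - 1) * (Real.cosh s / Real.sinh s) *
          deriv (fun t => f (Real.sinh t • Pi.single i 1)) s)) s := by
  have hτ : 0 < Real.sinh s := Real.sinh_pos_iff.2 hs
  have hcs := Real.cosh_sq s
  set a : Fin n → ℝ := Pi.single i 1 with ha
  obtain ⟨e1, e2⟩ := deriv_along_curve (γ := fun s => Real.sinh s • a) (t := s) hf
    (contDiff_sinh_smul a) (fun s => (Real.hasDerivAt_sinh s).smul_const a)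
    ((Real.hasDerivAt_cosh s).smul_const a)
  have hd : DifferentiableAt ℝ (deriv fun t => f (Real.sinh t • a)) s := by
    have h := contDiffAt_fderiv_apply
      (hf.comp s (f := fun t => Real.sinh t • a) (contDiff_sinh_smul a).contDiffAt) (1 : ℝ)
    have h2 := h.differentiableAt (by simp)
    simp only [fderiv_apply_one_eq_deriv] at h2
    exact h2
  have hD := hd.hasDerivAt
  set τ := Real.sinh s
  set c := Real.cosh s
  set w := deriv (fun t => f (Real.sinh t • a)) s
  set G := grad f (τ • a) with hG
  set A := hess f (τ • a) with hA
  have hk : ∀ k, k ≠ i → G k = 0 ∧ A k k = G i / τ := fun k hk =>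
    grad_hess_of_radial hk hτ hsR hf hr
  have hGa : G = G i • a := by
    ext k
    by_cases h : k = i
    · subst h; simp [ha]
    · rw [(hk k h).1]; simp [ha, h]
  have htr : A.trace = A i i + ((n : ℝ) - 1) * (G i / τ) := by
    rw [Matrix.trace, ← Finset.add_sum_erase _ _ (Finset.mem_univ i),
      Finset.sum_congr rfl fun k hk' => (show A.diag k = G i / τ from (hk k
        (Finset.ne_of_mem_erase hk')).2)]
    have hn : 1 ≤ n := by have := i.2; omega
    simp [Finset.card_erase_of_mem, Nat.cast_sub hn]
  have hGx : G ⬝ᵥ (τ • a) = τ * G i := by simp [ha]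
  have hGG : G ⬝ᵥ G = G i ^ 2 := by
    conv_lhs => rw [hGa]
    simp [ha]; ring
  have haA : a ⬝ᵥ A *ᵥ a = A i i := by simp [ha]
  have hw : w = c * G i := by rw [e1]; simp [ha]
  have hw' : deriv (deriv fun t => f (Real.sinh t • a)) s = c ^ 2 * A i i + τ * G i := by
    rw [e2]
    simp only [Matrix.mulVec_smul, dotProduct_smul, smul_dotProduct, haA, smul_eq_mul]
    simp [ha]; ring
  have hN : conormSq (τ • a) G = w ^ 2 := by
    rw [conormSq, hGx, hGG, hw]; linear_combination -(G i ^ 2) * hcs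
  have hraise : raise (τ • a) G = (c * w) • a := by
    rw [raise, hGx]
    conv_lhs => rw [hGa]
    rw [smul_smul, ← add_smul, hw]
    congr 1
    simp [ha]
    linear_combination -(G i) * hcs
  have h1 := hsol.1
  rw [← hG, hN] at h1
  have h2 := hsol.2
  rw [← hG, ← hA, translatorOp, hN, hraise, htr, hGx] at h2
  simp only [Matrix.mulVec_smul, dotProduct_smul, smul_dotProduct, haA, smul_eq_mul] at h2
  refine ⟨by rwa [← sq_lt_one_iff_abs_lt_one], ?_⟩
  rw [hw'] at hD
  refine hD.congr_deriv ?_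
  have h3 : G i / τ + τ * G i = c * w / τ := by
    rw [hw]; field_simp; linear_combination -(G i) * hcs
  have h4 : (1 - w ^ 2) * (c ^ 2 * A i i + ((n : ℝ) - 1) * (c * w / τ) + τ * G i - 1) +
      w ^ 2 * (c ^ 2 * A i i + τ * G i) = 0 := by
    rw [← h3]
    linear_combination h2 + (1 - w ^ 2) * A i i * hcs
  linear_combination h4

/-! ### Continuation of solutions of the profile equation -/

/-- Right hand side of the profile equation. -/
noncomputable def profileField (n : ℕ) (s w : ℝ) : ℝ :=
  (1 - w ^ 2) * (1 - ((n : ℝ) - 1) * (Real.cosh s / Real.sinh s) * w)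

theorem exists_bound_coth (n : ℕ) {a b : ℝ} (ha : 0 < a) : ∃ B : NNReal, ∀ s ∈ Set.Icc a b,
    |((n : ℝ) - 1) * (Real.cosh s / Real.sinh s)| ≤ B := by
  have hc : ContinuousOn (fun s => ((n : ℝ) - 1) * (Real.cosh s / Real.sinh s)) (Set.Icc a b) :=
    continuousOn_const.mul (Real.continuous_cosh.continuousOn.div Real.continuous_sinh.continuousOn
      fun s hs => (Real.sinh_pos_iff.2 (ha.trans_le hs.1)).ne')
  obtain ⟨B, hB⟩ := isCompact_Icc.exists_bound_of_continuousOn hc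
  exact ⟨B.toNNReal, fun s hs => (hB s hs).trans (Real.le_coe_toNNReal B)⟩

theorem hasDerivAt_tanh (x : ℝ) : HasDerivAt Real.tanh (1 - Real.tanh x ^ 2) x := by
  have h0 := (Real.cosh_pos x).ne'
  have h := (Real.hasDerivAt_sinh x).div (Real.hasDerivAt_cosh x) h0
  have h2 : Real.tanh = Real.sinh / Real.cosh := funext Real.tanh_eq_sinh_div_cosh
  rw [h2]
  refine h.congr_deriv ?_
  rw [Pi.div_apply]
  field_simp

theorem abs_tanh_lt (x : ℝ) : |Real.tanh x| < 1 := abs_lt.2 ⟨Real.neg_one_lt_tanh x, Real.tanh_lt_one x⟩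

theorem lipschitzWith_tanh : LipschitzWith 1 Real.tanh := by
  refine lipschitzWith_of_nnnorm_deriv_le (fun x => (hasDerivAt_tanh x).differentiableAt) fun x => ?_
  rw [(hasDerivAt_tanh x).deriv, ← NNReal.coe_le_coe, coe_nnnorm, Real.norm_eq_abs]
  have h1 := (sq_lt_one_iff_abs_lt_one (Real.tanh x)).2 (abs_tanh_lt x)
  rw [abs_of_pos (by linarith)]
  have := sq_nonneg (Real.tanh x)
  simp; linarith

/-- With w = tanh θ the factor 1 - w² disappears: θ' = 1 - (n-1) coth(s) tanh θ. The right side is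
bounded by 1 + B and B-Lipschitz in θ, so one Picard–Lindelöf step covers the whole interval, and
|w| < 1 is automatic. -/
theorem exists_profile_on (n : ℕ) {a s₀ b w₀ : ℝ} (ha : 0 < a) (hs : s₀ ∈ Set.Ioo a b)
    (hw : |w₀| < 1) : ∃ w : ℝ → ℝ, w s₀ = w₀ ∧ ∀ s ∈ Set.Ioo a b, |w s| < 1 ∧
      HasDerivAt w (profileField n s (w s)) s := by
  obtain ⟨B, hB⟩ := exists_bound_coth n (b := b) ha
  set v : ℝ → ℝ → ℝ := fun s θ => 1 - ((n : ℝ) - 1) * (Real.cosh s / Real.sinh s) * Real.tanh θ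
    with hv
  have hab : 0 ≤ b - a := by linarith [hs.1, hs.2]
  have hPL : IsPicardLindelof v (⟨s₀, hs.1.le, hs.2.le⟩ : Set.Icc a b) (Real.artanh w₀)
      ((1 + B) * (b - a).toNNReal) 0 (1 + B) B := by
    refine ⟨fun t ht => ?_, fun x _ => ?_, fun t ht x _ => ?_, ?_⟩
    · refine (LipschitzWith.of_dist_le_mul fun x y => ?_).lipschitzOnWith
      rw [Real.dist_eq, Real.dist_eq, hv]
      have h1 := lipschitzWith_tanh.dist_le_mul y x
      rw [Real.dist_eq, Real.dist_eq, NNReal.coe_one, one_mul, abs_sub_comm y x] at h1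
      have h2 : 1 - ((n : ℝ) - 1) * (Real.cosh t / Real.sinh t) * Real.tanh x -
          (1 - ((n : ℝ) - 1) * (Real.cosh t / Real.sinh t) * Real.tanh y) =
          ((n : ℝ) - 1) * (Real.cosh t / Real.sinh t) * (Real.tanh y - Real.tanh x) := by ring
      simp only
      rw [h2, abs_mul]
      exact mul_le_mul (hB t ht) h1 (abs_nonneg _) B.2
    · refine continuousOn_const.sub (ContinuousOn.mul ?_ continuousOn_const)
      exact continuousOn_const.mul (Real.continuous_cosh.continuousOn.div
        Real.continuous_sinh.continuousOn
        fun s hs => (Real.sinh_pos_iff.2 (ha.trans_le hs.1)).ne')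
    · rw [Real.norm_eq_abs]
      calc |v t x| ≤ |(1 : ℝ)| + |((n : ℝ) - 1) * (Real.cosh t / Real.sinh t) * Real.tanh x| :=
            abs_sub _ _
        _ ≤ 1 + B := by
            rw [abs_one, abs_mul]
            have := mul_le_mul (hB t ht) (abs_tanh_lt x).le (abs_nonneg _) B.2
            linarith
    · push_cast
      rw [Real.coe_toNNReal _ hab, sub_zero]
      have hB0 : (0 : ℝ) ≤ B := B.2
      refine mul_le_mul_of_nonneg_left (max_le ?_ ?_) (by positivity)
      · linarith [hs.1]
      · linarith [hs.2]
  obtain ⟨θ, hθ0, hθ⟩ := hPL.exists_eq_forall_mem_Icc_hasDerivWithinAt₀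
  refine ⟨fun s => Real.tanh (θ s), ?_, fun s hs' => ⟨abs_tanh_lt _, ?_⟩⟩
  · simp only at hθ0 ⊢
    rw [hθ0, Real.tanh_artanh (by rwa [Set.mem_Ioo, ← abs_lt])]
  · have h1 := (hθ s ⟨hs'.1.le, hs'.2.le⟩).hasDerivAt (Icc_mem_nhds hs'.1 hs'.2)
    exact (hasDerivAt_tanh (θ s)).comp s h1

theorem profile_unique (n : ℕ) {a s₀ b : ℝ} (ha : 0 < a) (hs : s₀ ∈ Set.Ioo a b)
    {w₁ w₂ : ℝ → ℝ}
    (h₁ : ∀ s ∈ Set.Ioo a b, |w₁ s| < 1 ∧ HasDerivAt w₁ (profileField n s (w₁ s)) s)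
    (h₂ : ∀ s ∈ Set.Ioo a b, |w₂ s| < 1 ∧ HasDerivAt w₂ (profileField n s (w₂ s)) s)
    (h : w₁ s₀ = w₂ s₀) : Set.EqOn w₁ w₂ (Set.Ioo a b) := by
  obtain ⟨B, hB⟩ := exists_bound_coth n (b := b) ha
  refine ODE_solution_unique_of_mem_Ioo (v := profileField n) (s := fun _ => {w | |w| < 1})
    (K := 2 + 4 * B) (fun t ht => ?_) hs (fun t ht => (h₁ t ht).symm) (fun t ht => (h₂ t ht).symm) h
  refine LipschitzOnWith.of_dist_le_mul fun x hx y hy => ?_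
  rw [Real.dist_eq, Real.dist_eq, profileField, profileField]
  have hk := hB t ⟨ht.1.le, ht.2.le⟩
  set k := ((n : ℝ) - 1) * (Real.cosh t / Real.sinh t)
  have e : (1 - x ^ 2) * (1 - k * x) - (1 - y ^ 2) * (1 - k * y) =
      (-(x + y) + k * (x ^ 2 + x * y + y ^ 2 - 1)) * (x - y) := by ring
  rw [e, abs_mul]
  refine mul_le_mul_of_nonneg_right ?_ (abs_nonneg _)
  have hx1 : |x| < 1 := hx
  have hy1 : |y| < 1 := hy
  rw [abs_lt] at hx1 hy1
  have hq : |x ^ 2 + x * y + y ^ 2 - 1| ≤ 4 := by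
    rw [abs_le]; constructor <;> nlinarith
  have hxy : |-(x + y)| ≤ 2 := by rw [abs_le]; constructor <;> linarith
  push_cast
  calc _ ≤ |-(x + y)| + |k * (x ^ 2 + x * y + y ^ 2 - 1)| := abs_add_le _ _
    _ ≤ 2 + 4 * B := by
      rw [abs_mul]
      have := mul_le_mul hk hq (abs_nonneg _) B.2
      linarith

theorem extend_profile (n : ℕ) {r : ℝ} (hr : 0 < r) {w : ℝ → ℝ}
    (h : ∀ s, 0 < s → s < r → |w s| < 1 ∧ HasDerivAt w (profileField n s (w s)) s) :
    ∃ W : ℝ → ℝ, (∀ s < r, W s = w s) ∧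
      ∀ s, 0 < s → |W s| < 1 ∧ HasDerivAt W (profileField n s (W s)) s := by
  have hw0 : |w (r / 2)| < 1 := (h (r / 2) (by linarith) (by linarith)).1
  have hmem : ∀ m : ℕ, r / 2 ∈ Set.Ioo (r / 4) (r + m) := fun m =>
    ⟨by linarith, by have : (0 : ℝ) ≤ m := m.cast_nonneg; linarith⟩
  choose V hV0 hV using fun m : ℕ =>
    exists_profile_on n (a := r / 4) (by linarith) (hmem m) hw0
  have hVw : ∀ m, ∀ s, r / 4 < s → s < r → V m s = w s := by
    intro m s hs1 hs2
    have hm : (0 : ℝ) ≤ m := m.cast_nonneg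
    refine profile_unique n (a := r / 4) (b := r) (by linarith) ⟨by linarith, by linarith⟩
      (fun s hs => hV m s ⟨hs.1, by linarith [hs.2]⟩)
      (fun s hs => h s (by linarith [hs.1]) hs.2) (hV0 m) ⟨hs1, hs2⟩
  have hVV : ∀ m k : ℕ, ∀ s, r / 4 < s → s < r + m → s < r + k → V m s = V k s := by
    intro m k s hs1 hs2 hs3
    refine profile_unique n (a := r / 4) (b := min (r + m) (r + k)) (s₀ := r / 2) (by linarith)
      ⟨by linarith, lt_min (hmem m).2 (hmem k).2⟩
      (fun s hs => hV m s ⟨hs.1, hs.2.trans_le (min_le_left _ _)⟩)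
      (fun s hs => hV k s ⟨hs.1, hs.2.trans_le (min_le_right _ _)⟩)
      ((hV0 m).trans (hV0 k).symm) ⟨hs1, lt_min hs2 hs3⟩
  classical
  -- Any V m with s < r + m gives the same value at s, by uniqueness; the index ⌈s⌉₊ always
  -- qualifies because r > 0.
  set W : ℝ → ℝ := fun s => if s < r then w s else V (⌈s⌉₊) s with hW
  have hWw : ∀ s < r, W s = w s := fun s hs => if_pos hs
  have hWV : ∀ m : ℕ, ∀ s, r / 4 < s → s < r + m → W s = V m s := by
    intro m s hs1 hs2
    by_cases hsr : s < r
    · rw [hWw s hsr, hVw m s hs1 hsr]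
    · have : W s = V (⌈s⌉₊) s := if_neg hsr
      rw [this]
      refine hVV _ _ s hs1 ?_ hs2
      linarith [Nat.le_ceil s]
  refine ⟨W, hWw, fun s hs => ?_⟩
  by_cases hsr : s < r
  · obtain ⟨h1, h2⟩ := h s hs hsr
    rw [hWw s hsr]
    refine ⟨h1, h2.congr_of_eventuallyEq ?_⟩
    filter_upwards [Iio_mem_nhds hsr] with t ht using hWw t ht
  · push Not at hsr
    have hsm : s < r + ⌈s⌉₊ := by linarith [Nat.le_ceil s]
    obtain ⟨h1, h2⟩ := hV ⌈s⌉₊ s ⟨by linarith, hsm⟩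
    rw [hWV _ s (by linarith) hsm]
    refine ⟨h1, h2.congr_of_eventuallyEq ?_⟩
    filter_upwards [Ioo_mem_nhds (by linarith : r / 4 < s) hsm] with t ht using hWV _ t ht.1 ht.2

/-- A function on `[0, r]` whose derivative solves the profile equation extends to a profile of
the bowl. -/
theorem exists_bowlProfile (n : ℕ) {r : ℝ} (hr : 0 < r) {g w : ℝ → ℝ}
    (hg : ContinuousOn g (Set.Icc 0 r)) (hgw : ∀ s, 0 ≤ s → s < r → HasDerivAt g (w s) s)
    (hw0 : w 0 = 0) (hwc : ContinuousAt w 0)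
    (h : ∀ s, 0 < s → s < r → |w s| < 1 ∧ HasDerivAt w (profileField n s (w s)) s) :
    ∃ f : ℝ → ℝ, IsBowlProfile n f ∧ ∀ s ∈ Set.Icc 0 r, f s = g s := by
  obtain ⟨W, hWw, hW⟩ := extend_profile n hr h
  have hW0 : W 0 = 0 := (hWw 0 hr).trans hw0
  have hWc : ContinuousOn W (Set.Ici 0) := by
    intro s hs
    rcases (Set.mem_Ici.1 hs).eq_or_lt with rfl | hs
    · refine (hwc.congr ?_).continuousWithinAt
      filter_upwards [Iio_mem_nhds hr] with t ht using (hWw t ht).symm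
    · exact (hW s hs).2.continuousAt.continuousWithinAt
  -- Extending W by its value at 0 gives a continuous integrand on ℝ, hence a two-sided derivative
  -- of the primitive even at 0.
  have hWm : Continuous fun s => W (max s 0) :=
    hWc.comp_continuous (by fun_prop) fun s => Set.mem_Ici.2 (le_max_right _ _)
  set F : ℝ → ℝ := fun s => g 0 + ∫ t in (0 : ℝ)..s, W (max t 0) with hF
  have hFd : ∀ s, 0 ≤ s → HasDerivAt F (W s) s := by
    intro s hs
    have := (hWm.integral_hasStrictDerivAt 0 s).hasDerivAt.const_add (g 0)
    rwa [max_eq_left hs] at this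
  refine ⟨F, ⟨W, hWc, hW0, fun s hs => ?_, fun s hs => (hW s hs).2,
    fun s hs => (hFd s hs).hasDerivWithinAt⟩, fun s hs => ?_⟩
  · rcases hs.eq_or_lt with rfl | hs
    · rw [hW0]; simp
    · exact (hW s hs).1
  · have hFc : ContinuousOn F (Set.Icc 0 r) := fun s hs =>
      (hFd s hs.1).continuousAt.continuousWithinAt
    -- Right derivatives on [0, r) together with continuity reach the endpoint r, where g need not
    -- be differentiable.
    have := constant_of_has_deriv_right_zero (f := fun s => F s - g s) (hFc.sub hg)
      (fun s hs => by
        have := (hFd s hs.1).sub (hgw s hs.1 hs.2)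
        rw [hWw s hs.2, sub_self] at this
        exact this.hasDerivWithinAt) s hs
    have h0 : F 0 - g 0 = 0 := by simp [hF]
    simp only [h0] at this
    exact sub_eq_zero.1 this

/-! ### Conclusion -/

/-- The dictionary |x| = sinh d, which turns geodesic balls about `c` into Euclidean balls about 0.
-/
theorem hdist_chart_recenter_spec {n : ℕ} (c : Hyp n) (x : Fin n → ℝ) :
    0 ≤ hdist (chart (recenter c x)) c ∧ Real.sinh (hdist (chart (recenter c x)) c) ^ 2 = x ⬝ᵥ x := by
  have h0 : 0 ≤ x ⬝ᵥ x := Finset.sum_nonneg fun _ _ => mul_self_nonneg _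
  have h1 : 1 ≤ Real.sqrt (1 + x ⬝ᵥ x) := Real.one_le_sqrt.2 (by linarith)
  rw [hdist_chart_recenter]
  refine ⟨Real.arcosh_nonneg h1, ?_⟩
  rw [Real.sinh_sq, Real.cosh_arcosh h1, Real.sq_sqrt (by linarith)]
  ring

theorem sinh_sq_lt_sinh_sq {a b : ℝ} (ha : 0 ≤ a) (hb : 0 ≤ b) :
    Real.sinh a ^ 2 < Real.sinh b ^ 2 ↔ a < b := by
  rw [sq_lt_sq₀ (Real.sinh_nonneg_iff.2 ha) (Real.sinh_nonneg_iff.2 hb), Real.sinh_lt_sinh]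

theorem sinh_sq_le_sinh_sq {a b : ℝ} (ha : 0 ≤ a) (hb : 0 ≤ b) :
    Real.sinh a ^ 2 ≤ Real.sinh b ^ 2 ↔ a ≤ b := by
  rw [← not_lt, sinh_sq_lt_sinh_sq hb ha, not_lt]

theorem chart_recenter_mem_ball {n : ℕ} {c : Hyp n} {r : ℝ} (hr : 0 ≤ r) {x : Fin n → ℝ} :
    chart (recenter c x) ∈ ball c r ↔ x ⬝ᵥ x < Real.sinh r ^ 2 := by
  obtain ⟨h1, h2⟩ := hdist_chart_recenter_spec c x
  rw [← h2, sinh_sq_lt_sinh_sq h1 hr]; rfl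

theorem chart_recenter_mem_closedBall {n : ℕ} {c : Hyp n} {r : ℝ} (hr : 0 ≤ r) {x : Fin n → ℝ} :
    chart (recenter c x) ∈ closedBall c r ↔ x ⬝ᵥ x ≤ Real.sinh r ^ 2 := by
  obtain ⟨h1, h2⟩ := hdist_chart_recenter_spec c x
  rw [← h2, sinh_sq_le_sinh_sq h1 hr]; rfl

theorem chart_recenter_mem_sphere {n : ℕ} {c : Hyp n} {r : ℝ} (hr : 0 ≤ r) {x : Fin n → ℝ}
    (hx : x ⬝ᵥ x = Real.sinh r ^ 2) : chart (recenter c x) ∈ sphere c r := by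
  obtain ⟨h1, h2⟩ := hdist_chart_recenter_spec c x
  rw [← h2] at hx
  exact le_antisymm ((sinh_sq_le_sinh_sq h1 hr).1 hx.le) ((sinh_sq_le_sinh_sq hr h1).1 hx.ge)

theorem chart_recenter_eq_center {n : ℕ} {c : Hyp n} {x : Fin n → ℝ} :
    chart (recenter c x) = c ↔ x = 0 := by
  constructor
  · intro h
    have h2 : chart (recenter c x) = chart (recenter c 0) := h.trans (recenter_zero c).symm
    have h3 : recenter c x = recenter c 0 := by
      ext i
      have := congrFun (congrArg Subtype.val h2) i.castSucc
      simpa [chart, chartVec_castSucc] using this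
    rw [← recenter_recenter c x, h3, recenter_recenter]
  · rintro rfl; exact recenter_zero c

theorem contDiffAt_of_isC2On {n : ℕ} {c : Hyp n} {u : Hyp n → ℝ} {U : Set (Hyp n)}
    {V : Set (Fin n → ℝ)} (hu : IsC2On u U) (hV : IsOpen V)
    (hVU : ∀ x, chart (recenter c x) ∈ U ↔ x ∈ V) {x : Fin n → ℝ} (hx : x ∈ V) :
    ContDiffAt ℝ 2 (fun y => u (chart y)) (recenter c x) := by
  have h : chart ⁻¹' U = recenter c ⁻¹' V := by
    ext y
    rw [Set.mem_preimage, Set.mem_preimage, ← hVU, recenter_recenter]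
  refine hu.contDiffAt ?_
  rw [h]
  refine (hV.preimage (contDiff_recenter (k := 0) c).continuous).mem_nhds ?_
  rwa [Set.mem_preimage, recenter_recenter]

theorem deriv_zero_of_even {g : ℝ → ℝ} (h : ∀ᶠ s in nhds (0 : ℝ), g (-s) = g s) :
    deriv g 0 = 0 := by
  have h1 : (fun s => g (-s)) =ᶠ[nhds 0] g := h
  have h2 := h1.deriv_eq
  rw [deriv_comp_neg, neg_zero] at h2
  linarith

theorem rotationallyInvariant_graphOver {n : ℕ} {c : Hyp n} {r : ℝ} {u : Hyp n → ℝ}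
    (h : ∀ p q, hdist p c ≤ r → hdist p c = hdist q c → u p = u q) :
    RotationallyInvariant c (graphOver u (closedBall c r)) := by
  intro σ hσ hσc
  have hd : ∀ p, hdist (σ p) c = hdist p c := fun p => by
    conv_lhs => rw [← hσc]
    exact hσ p c
  ext ⟨q, t⟩
  constructor
  · rintro ⟨⟨p, t'⟩, ⟨hp, ht⟩, he⟩
    obtain ⟨rfl, rfl⟩ := Prod.mk.inj he
    have hp' : hdist p c ≤ r := hp
    exact ⟨(hd p).trans_le hp', (show t' = u p from ht).trans (h p _ hp' (hd p).symm)⟩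
  · rintro ⟨hq, ht⟩
    have hq' : hdist q c ≤ r := hq
    have hs : hdist (σ.symm q) c = hdist q c := by rw [← hd (σ.symm q), σ.apply_symm_apply]
    exact ⟨(σ.symm q, t), ⟨hs.trans_le hq', (show t = u q from ht).trans (h q _ hq' hs.symm)⟩,
      by simp⟩

end HESU

open scoped Matrix in
theorem mainTheorem7 (n : ℕ) (hn : 2 ≤ n) (c : HESU.Hyp n) (r : ℝ) (hr : 0 < r)
    (u : HESU.Hyp n → ℝ)
    (hcont : ContinuousOn u (HESU.closedBall c r \ {c}))
    (htrans : HESU.IsSpacelikeTranslatorOn u (HESU.puncturedBall c r))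
    (hconst : ∃ k : ℝ, ∀ p ∈ HESU.sphere c r, u p = k) :
    HESU.RotationallyInvariant c (HESU.graphOver u (HESU.closedBall c r)) ∧
    (HESU.IsC2On u (HESU.ball c r) →
      ∃ f : ℝ → ℝ, HESU.IsBowlProfile n f ∧
        IsCompact (HESU.graphOver u (HESU.closedBall c r)) ∧
        HESU.graphOver u (HESU.closedBall c r) =
          HESU.bowl c f ∩ (HESU.closedBall c r ×ˢ Set.univ)) := by
  open HESU in
  obtain ⟨k, hk⟩ := hconst
  set R := Real.sinh r ^ 2 with hRdef
  have hR : 0 < R := pow_pos (Real.sinh_pos_iff.2 hr) 2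
  set f : (Fin n → ℝ) → ℝ := fun y => u (chart (recenter c y)) with hf
  have hcr : Continuous fun y : Fin n → ℝ => chart (recenter c y) :=
    continuous_chart.comp (contDiff_recenter (k := 0) c).continuous
  set V : Set (Fin n → ℝ) := {x | x ⬝ᵥ x < R} ∩ {0}ᶜ with hV
  have hVo : IsOpen V := (isOpen_dotProduct_lt R).inter isOpen_compl_singleton
  have hVU : ∀ x, chart (recenter c x) ∈ puncturedBall c r ↔ x ∈ V := fun x =>
    and_congr (chart_recenter_mem_ball hr.le) (not_congr chart_recenter_eq_center)
  have hu2 : ∀ x ∈ V, ContDiffAt ℝ 2 (fun y => u (chart y)) (recenter c x) := fun x hx =>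
    contDiffAt_of_isC2On htrans.1 hVo hVU hx
  have hfC : ∀ x, 0 < x ⬝ᵥ x → x ⬝ᵥ x < R → ContDiffAt ℝ 2 f x := fun x h1 h2 =>
    (hu2 x ⟨h2, dotProduct_self_pos.1 h1⟩).comp x (contDiff_recenter c).contDiffAt
  have hfS : ∀ x, 0 < x ⬝ᵥ x → x ⬝ᵥ x < R → SolvesAt f x := fun x h1 h2 => by
    have hx : x ∈ V := ⟨h2, dotProduct_self_pos.1 h1⟩
    obtain ⟨hp, ht⟩ := htrans.2 (recenter c x) ((hVU x).2 hx)
    have := solvesAt_of_translator c u (recenter c x) (hu2 x hx) hp ht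
    rwa [recenter_recenter] at this
  have hfc : ContinuousOn f ({x | x ⬝ᵥ x ≤ R} \ {0}) :=
    hcont.comp hcr.continuousOn fun x hx =>
      ⟨(chart_recenter_mem_closedBall hr.le).2 hx.1, fun h => hx.2 (chart_recenter_eq_center.1 h)⟩
  have hrad : ∀ x y : Fin n → ℝ, x ⬝ᵥ x ≤ R → x ⬝ᵥ x = y ⬝ᵥ y → f x = f y := fun x y =>
    radial_of_solves hn hR hfC hfS hfc fun x hx => hk _ (chart_recenter_mem_sphere hr.le hx)
  refine ⟨rotationallyInvariant_graphOver fun p q hp hpq => ?_, fun hC2 => ?_⟩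
  · obtain ⟨x, rfl⟩ := exists_chart_recenter c p
    obtain ⟨y, rfl⟩ := exists_chart_recenter c q
    refine hrad x y ((chart_recenter_mem_closedBall hr.le).1 hp) ?_
    rw [← (hdist_chart_recenter_spec c x).2, ← (hdist_chart_recenter_spec c y).2, hpq]
  have hfC' : ∀ x, x ⬝ᵥ x < R → ContDiffAt ℝ 2 f x := fun x hx =>
    (contDiffAt_of_isC2On hC2 (isOpen_dotProduct_lt R)
      (fun x => chart_recenter_mem_ball hr.le) hx).comp x (contDiff_recenter c).contDiffAt
  have hfc' : ContinuousOn f {x | x ⬝ᵥ x ≤ R} := by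
    intro x hx
    by_cases hx0 : x = 0
    · subst hx0
      exact (hfC' 0 (by simpa using hR)).continuousAt.continuousWithinAt
    · exact (hfc x ⟨hx, hx0⟩).mono_of_mem_nhdsWithin (Filter.inter_mem self_mem_nhdsWithin
        (mem_nhdsWithin_of_mem_nhds (isOpen_compl_singleton.mem_nhds hx0)))
  set i : Fin n := ⟨0, by omega⟩
  set γ : ℝ → Fin n → ℝ := fun s => Real.sinh s • Pi.single i 1 with hγ
  have hγγ : ∀ s, γ s ⬝ᵥ γ s = Real.sinh s ^ 2 := fun s => by simp [hγ, pow_two]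
  have hγC : ContDiff ℝ 2 γ := contDiff_sinh_smul _
  have hlt : ∀ s, 0 ≤ s → s < r → γ s ⬝ᵥ γ s < R := fun s h0 hs => by
    rw [hγγ]; exact (sinh_sq_lt_sinh_sq h0 hr.le).2 hs
  have hgC : ∀ s, 0 ≤ s → s < r → ContDiffAt ℝ 2 (fun s => f (γ s)) s := fun s h0 hs =>
    (hfC' _ (hlt s h0 hs)).comp s hγC.contDiffAt
  obtain ⟨F, hF, hFg⟩ := exists_bowlProfile n hr (g := fun s => f (γ s))
    (w := deriv fun s => f (γ s))
    (hfc'.comp hγC.continuous.continuousOn fun s hs => by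
      rw [Set.mem_ofPred_eq, hγγ]; exact (sinh_sq_le_sinh_sq hs.1 hr.le).2 hs.2)
    (fun s h0 hs => ((hgC s h0 hs).differentiableAt (by simp)).hasDerivAt)
    -- The points at parameters s and -s have the same length, so radial symmetry makes the
    -- restriction even near 0.
    (deriv_zero_of_even (by
      filter_upwards [hγC.continuous.continuousAt.eventually
        ((isOpen_dotProduct_lt R).mem_nhds (hlt 0 le_rfl hr))] with s hs
      refine (hrad _ _ (le_of_lt hs) ?_).symm
      rw [hγγ, hγγ, Real.sinh_neg, neg_sq]))
    (by
      have := (contDiffAt_fderiv_apply (hgC 0 le_rfl hr) (1 : ℝ)).continuousAt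
      simpa only [fderiv_apply_one_eq_deriv] using this)
    (fun s h0 hs => profile_ode i h0 ((sinh_sq_lt_sinh_sq h0.le hr.le).2 hs)
      (hfC' _ (hlt s h0.le hs))
      (hfS _ (by rw [hγγ]; exact pow_pos (Real.sinh_pos_iff.2 h0) 2) (hlt s h0.le hs))
      fun x y hx => hrad x y hx.le)
  have huF : ∀ p ∈ closedBall c r, u p = F (hdist p c) := by
    intro p hp
    obtain ⟨x, rfl⟩ := exists_chart_recenter c p
    obtain ⟨h1, h2⟩ := hdist_chart_recenter_spec c x
    rw [hFg _ ⟨h1, hp⟩]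
    exact hrad _ _ ((chart_recenter_mem_closedBall hr.le).1 hp) (by rw [hγγ, h2])
  refine ⟨F, hF, ?_, ?_⟩
  · have : graphOver u (closedBall c r) =
        (fun x => (chart (recenter c x), f x)) '' {x | x ⬝ᵥ x ≤ R} := by
      ext ⟨p, t⟩
      constructor
      · rintro ⟨hp, ht⟩
        obtain ⟨x, rfl⟩ := exists_chart_recenter c p
        exact ⟨x, (chart_recenter_mem_closedBall hr.le).1 hp, Prod.ext rfl ht.symm⟩
      · rintro ⟨x, hx, he⟩
        obtain ⟨rfl, rfl⟩ := Prod.mk.inj he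
        exact ⟨(chart_recenter_mem_closedBall hr.le).2 hx, rfl⟩
    rw [this]
    exact (isCompact_dotProduct_le R).image_of_continuousOn (hcr.continuousOn.prodMk hfc')
  · ext ⟨p, t⟩
    constructor
    · rintro ⟨hp, ht⟩
      exact ⟨(show t = u p from ht).trans (huF p hp), hp, trivial⟩
    · rintro ⟨ht, hp, -⟩
      exact ⟨hp, (show t = F (hdist p c) from ht).trans (huF p hp).symm⟩
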